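/- There are universal constants $K$ and $c$ such that the following holds. Let $A$ and $B$ be systems of $a\ge 0$ and $b\ge 0$ qubits, let $n=a+b$ and $d\ge 1$, and let $U_{AB}$ be a unitary on these $n$ qubits that has a Clifford+$T$ decomposition of $T$-depth $d$, i.e. $$U_{AB}=C_{d+1}\bar T_d C_d\bar T_{d-1}\cdots \bar T_1C_1,$$ where each $C_i$ is an $n$-qubit Clifford unitary (a unitary that conjugates the $n$-qubit Pauli group, with phases $\pm1,\pm i$, into itself) and each $\bar T_i$ applies the gate $T=\mathrm{diag}(1,e^{i\pi/4})$ to each qubit in some (possibly empty) set of qubits. Then for some $m\le c\,(Kn)^d$ the channel $\rho\mapsto U_{AB}\,\rho\, U_{AB}^\dagger$ can be implemented exactly as a non-local quantum computation using $m$ EPR pairs. That is, there are finite-dimensional systems $K_a,M_a,K_b,M_b$ and quantum channels $\mathcal V^A_{AL\to K_aM_b}$, $\mathcal V^B_{RB\to M_aK_b}$, $\mathcal W^A_{K_aM_a\to A}$, $\mathcal W^B_{K_bM_b\to B}$ such that for all $\rho$ $$\big(\mathcal W^A\otimes\mathcal W^B\big)\circ\big(\mathcal V^A\otimes\mathcal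 V^B\big)\big(\rho_{AB}\otimes\Psi_{LR}\big)=U_{AB}\,\rho\,U_{AB}^\dagger ,$$ where $\Psi_{LR}$ consists of $m$ EPR pairs $\tfrac1{\sqrt2}(|00\rangle+|11\rangle)$, one half of each in $L$ and the other in $R$. In short, the number of EPR pairs needed is $E(U_{AB})\le O((Kn)^d)$. -/

import Mathlib

open scoped Matrix Kronecker

noncomputable section

/-! ### Qubits, Paulis, Cliffords and Clifford+T circuits

The qubits are labelled by a finite type `ι`; computational basis states are functions
`ι → Fin 2`, and operators are complex matrices indexed by them. -/

/-- Operators on the qubits labelled by `ι`. -/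
abbrev QubitOp (ι : Type*) : Type _ := Matrix (ι → Fin 2) (ι → Fin 2) ℂ

/-- The tensor product `⨂ i, M i` of single-qubit operators. -/
def qubitTensor {ι : Type*} [Fintype ι] (M : ι → Matrix (Fin 2) (Fin 2) ℂ) : QubitOp ι :=
  Matrix.of fun r c => ∏ i, M i (r i) (c i)

/-- The single-qubit Pauli matrices `I, X, Y, Z`. -/
def pauliMatrix : Fin 4 → Matrix (Fin 2) (Fin 2) ℂ :=
  ![1, !![0, 1; 1, 0], !![0, -Complex.I; Complex.I, 0], !![1, 0; 0, -1]]

/-- The Pauli group: tensor products of Pauli matrices with a phase in `{1, i, -1, -i}`. -/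
def pauliGroup (ι : Type*) [Fintype ι] : Set (QubitOp ι) :=
  {P | ∃ (k : ℕ) (s : ι → Fin 4), P = Complex.I ^ k • qubitTensor fun i => pauliMatrix (s i)}

/-- A Clifford unitary: a unitary that conjugates Pauli operators to Pauli operators. -/
def IsClifford {ι : Type*} [Fintype ι] [DecidableEq ι] (C : QubitOp ι) : Prop :=
  C ∈ Matrix.unitaryGroup (ι → Fin 2) ℂ ∧ ∀ P ∈ pauliGroup ι, Cᴴ * P * C ∈ pauliGroup ι

/-- The gate `T = diag(1, exp(iπ/4))`. -/
def tGate : Matrix (Fin 2) (Fin 2) ℂ :=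
  !![1, 0; 0, Complex.exp (Complex.I * (Real.pi / 4))]

/-- One layer of `T` gates: `T` on each qubit in `s`, the identity on the others. -/
def tLayer {ι : Type*} [Fintype ι] [DecidableEq ι] (s : Finset ι) : QubitOp ι :=
  qubitTensor fun i => if i ∈ s then tGate else 1

/-- `CliffordTDecomposition d U`: `U = C_{d+1} T_d C_d ⋯ T_1 C_1` with Clifford unitaries `C_i`
and layers `T_i` of `T` gates, i.e. `U` has a Clifford+T circuit of `T`-depth `d`. -/
inductive CliffordTDecomposition {ι : Type*} [Fintype ι] [DecidableEq ι] :
    ℕ → QubitOp ι → Prop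
  | clifford (C : QubitOp ι) (hC : IsClifford C) : CliffordTDecomposition 0 C
  | layer (d : ℕ) (V C : QubitOp ι) (s : Finset ι) (hV : CliffordTDecomposition d V)
      (hC : IsClifford C) : CliffordTDecomposition (d + 1) (C * tLayer s * V)

/-! ### Quantum channels -/

/-- A quantum channel between finite-dimensional systems: a linear map on operators with a
Kraus representation `ρ ↦ ∑ E_k ρ E_k†`, `∑ E_k† E_k = 1`. -/
def IsChannel {A B : Type*} [Fintype A] [DecidableEq A]
    [Fintype B] (Φ : Matrix A A ℂ →ₗ[ℂ] Matrix B B ℂ) : Prop :=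
  ∃ (κ : Type) (_ : Fintype κ) (E : κ → Matrix B A ℂ),
    ∑ k, (E k)ᴴ * E k = 1 ∧ ∀ ρ, Φ ρ = ∑ k, E k * ρ * (E k)ᴴ

/-- The tensor product `Φ ⊗ Ψ` of linear maps on operators. -/
def channelTensor {A B C D : Type*} [Fintype A] [DecidableEq A] [Fintype B] [DecidableEq B]
    (Φ : Matrix A A ℂ →ₗ[ℂ] Matrix C C ℂ) (Ψ : Matrix B B ℂ →ₗ[ℂ] Matrix D D ℂ)
    (ρ : Matrix (A × B) (A × B) ℂ) : Matrix (C × D) (C × D) ℂ :=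
  ∑ i, ∑ j, ∑ k, ∑ l,
    ρ (i, k) (j, l) • (Φ (Matrix.single i j 1) ⊗ₖ Ψ (Matrix.single k l 1))

theorem linearMap_eq_sum_single {A C : Type*} [Fintype A] [DecidableEq A]
    (Φ : Matrix A A ℂ →ₗ[ℂ] Matrix C C ℂ) (X : Matrix A A ℂ) :
    Φ X = ∑ i, ∑ j, X i j • Φ (Matrix.single i j 1) := by
  conv_lhs => rw [Matrix.matrix_eq_sum_single X]
  simp only [map_sum, ← map_smul, Matrix.smul_single, smul_eq_mul, mul_one]

/-- `channelTensor Φ Ψ` acts as `Φ` and `Ψ` on product operators. -/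
theorem channelTensor_kronecker {A B C D : Type*} [Fintype A] [DecidableEq A]
    [Fintype B] [DecidableEq B]
    (Φ : Matrix A A ℂ →ₗ[ℂ] Matrix C C ℂ) (Ψ : Matrix B B ℂ →ₗ[ℂ] Matrix D D ℂ)
    (X : Matrix A A ℂ) (Y : Matrix B B ℂ) :
    channelTensor Φ Ψ (X ⊗ₖ Y) = Φ X ⊗ₖ Ψ Y := by
  rw [linearMap_eq_sum_single Φ X, linearMap_eq_sum_single Ψ Y]
  ext ⟨c, d⟩ ⟨c', d'⟩
  simp only [channelTensor, Matrix.sum_apply, Matrix.smul_apply,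
    Matrix.kroneckerMap_apply, smul_eq_mul]
  simp only [Finset.sum_mul]
  simp only [Finset.mul_sum]
  refine Fintype.sum_congr _ _ fun i => Fintype.sum_congr _ _ fun j =>
    Fintype.sum_congr _ _ fun k => Fintype.sum_congr _ _ fun l => ?_
  ring

/-! ### Non-local quantum computation -/

/-- The map implemented by a non-local quantum computation with resource state `Ψ` on `LR`,
`(W_A ⊗ W_B) ∘ (V_A ⊗ V_B) (· ⊗ Ψ)`.  In the first round Alice acts on `AL`, keeping `Ka` and
sending `Mb`, while Bob acts on `RB`, keeping `Kb` and sending `Ma`; after the simultaneous exchange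
Alice acts on `Ka Ma` and Bob on `Kb Mb`. -/
def nlqcMap {A B L R Ka Ma Kb Mb A' B' : Type*}
    [Fintype A] [DecidableEq A] [Fintype B] [DecidableEq B]
    [Fintype L] [DecidableEq L] [Fintype R] [DecidableEq R]
    [Fintype Ka] [DecidableEq Ka] [Fintype Ma] [DecidableEq Ma]
    [Fintype Kb] [DecidableEq Kb] [Fintype Mb] [DecidableEq Mb]
    (Ψ : Matrix (L × R) (L × R) ℂ)
    (VA : Matrix (A × L) (A × L) ℂ →ₗ[ℂ] Matrix (Ka × Mb) (Ka × Mb) ℂ)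
    (VB : Matrix (R × B) (R × B) ℂ →ₗ[ℂ] Matrix (Ma × Kb) (Ma × Kb) ℂ)
    (WA : Matrix (Ka × Ma) (Ka × Ma) ℂ →ₗ[ℂ] Matrix A' A' ℂ)
    (WB : Matrix (Kb × Mb) (Kb × Mb) ℂ →ₗ[ℂ] Matrix B' B' ℂ)
    (ρ : Matrix (A × B) (A × B) ℂ) : Matrix (A' × B') (A' × B') ℂ :=
  let distribute : (A × L) × (R × B) → (A × B) × (L × R) :=
    fun p => ((p.1.1, p.2.2), (p.1.2, p.2.1))
  let exchange : (Ka × Ma) × (Kb × Mb) → (Ka × Mb) × (Ma × Kb) :=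
    fun p => ((p.1.1, p.2.2), (p.1.2, p.2.1))
  let firstRound := channelTensor VA VB ((ρ ⊗ₖ Ψ).submatrix distribute distribute)
  channelTensor WA WB (firstRound.submatrix exchange exchange)

/-- The amplitudes of an EPR pair `(|00⟩ + |11⟩) / √2`. -/
def eprAmplitude (l r : Fin 2) : ℂ := if l = r then 1 / (Real.sqrt 2 : ℂ) else 0

/-- The density matrix of `m` EPR pairs, one half of each held on either side. -/
def eprPairs (m : ℕ) :
    Matrix ((Fin m → Fin 2) × (Fin m → Fin 2)) ((Fin m → Fin 2) × (Fin m → Fin 2)) ℂ :=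
  let ψ : (Fin m → Fin 2) × (Fin m → Fin 2) → ℂ := fun p => ∏ i, eprAmplitude (p.1 i) (p.2 i)
  Matrix.vecMulVec ψ (star ψ)

/-- The operator `U` on `AB` can be implemented exactly, as the channel `ρ ↦ U ρ U†`, by a
non-local quantum computation whose resource state consists of `m` EPR pairs. -/
def ImplementableWithEPR {A B : Type*} [Fintype A] [DecidableEq A] [Fintype B] [DecidableEq B]
    (U : Matrix (A × B) (A × B) ℂ) (m : ℕ) : Prop :=
  ∃ (Ka Ma Kb Mb : Type) (_ : Fintype Ka) (_ : DecidableEq Ka) (_ : Fintype Ma)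
    (_ : DecidableEq Ma) (_ : Fintype Kb) (_ : DecidableEq Kb) (_ : Fintype Mb)
    (_ : DecidableEq Mb)
    (VA : Matrix (A × (Fin m → Fin 2)) (A × (Fin m → Fin 2)) ℂ →ₗ[ℂ]
      Matrix (Ka × Mb) (Ka × Mb) ℂ)
    (VB : Matrix ((Fin m → Fin 2) × B) ((Fin m → Fin 2) × B) ℂ →ₗ[ℂ]
      Matrix (Ma × Kb) (Ma × Kb) ℂ)
    (WA : Matrix (Ka × Ma) (Ka × Ma) ℂ →ₗ[ℂ] Matrix A A ℂ)
    (WB : Matrix (Kb × Mb) (Kb × Mb) ℂ →ₗ[ℂ] Matrix B B ℂ),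
    IsChannel VA ∧ IsChannel VB ∧ IsChannel WA ∧ IsChannel WB ∧
      ∀ ρ, nlqcMap (eprPairs m) VA VB WA WB ρ = U * ρ * Uᴴ

/-- An operator on the qubits of Alice (labelled by `α`) and of Bob (labelled by `β`), viewed as an
operator on the tensor product of Alice's system and Bob's system. -/
def bipartite {α β : Type*} (U : QubitOp (α ⊕ β)) :
    Matrix ((α → Fin 2) × (β → Fin 2)) ((α → Fin 2) × (β → Fin 2)) ℂ :=
  U.submatrix (fun p => Sum.elim p.1 p.2) (fun p => Sum.elim p.1 p.2)

end

/-!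
Bob teleports his qubits to Alice, who from then on holds all `n` qubits, encrypted by a Pauli error
`σ(p)` whose label `p` is a function of the measurement outcomes `x` of Alice and `y` of Bob
(`collectingProtocol_teleport`). No communication is needed as long as Alice can apply the gates of
the circuit to the encrypted data; after the single round of communication both parties know `x` and
`y` and undo the final error (`CollectsUpToPauli.implementableWithEPR`).

A Clifford gate acts on the labels by an additive map (`IsClifford.exists_label_hom`). A `T` gate
turns an `X` error into a phase error, `T σ(p) ∝ S ^ f σ(p) T` with `f` the `X`-component of `p`
(`tGate_mul_sigma`). The bit `f` depends on both `x` and `y`, so neither party can remove `S ^ f`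
alone. It is removed by routing. Suppose that a permutation program, in which Alice and Bob
alternately permute a set of states by permutations depending on their own data, adds `f` to a
target bit (`Computes`). Let its states label wires held by Alice. She permutes the wires
herself, and for Bob's permutations she teleports all wires to him and he teleports them back in
permuted order, so that the data qubit ends on a wire labelled by `f`
(`CollectingProtocol.bob_permutes`, `CollectingProtocol.route`). She applies `S†` to the wires
labelled by `1`, and a second run of the program returns the qubit to its place, since `f + f = 0`.
The state of every unused wire factors off.

The teleportations leave a new Pauli error, namely the sum of the errors along the path of the
qubit. It is again given by an alternating program of the same length, which acts on states together
with a Pauli label (`skewPerm`, `CollectingProtocol.remove_phases`), and running that program,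
copying a bit, and running it backwards computes any bit of the new error
(`Computes.of_altProgram`).

Programs for sums are obtained by composition, so that a layer of `T` gates multiplies the length of
the programs that compute linear functionals of the label by `4 n + 1` and the number of states
by `8` (`CollectsUpToPauli.apply_tLayer`). Initially the length is `1` because the label is known to
Bob. Layer `t`, counted from `0`, hence uses `8 n 8 ^ t (4 n + 1) ^ t` EPR pairs, and the sum over
the layers, together with the pairs for the initial teleportation, is at most `(40 n) ^ d`
(`epr_count_le`).
-/

noncomputable section

/-! ### Single-qubit Pauli and phase gates -/

/-- The code in `Fin 4` of the Pauli matrix `X ^ x Z ^ z` (up to phase) with label `(x, z)`. -/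
def pauliCode (e : ZMod 2 × ZMod 2) : Fin 4 :=
  if e.1 = 0 then (if e.2 = 0 then 0 else 3) else (if e.2 = 0 then 1 else 2)

/-- The Hermitian Pauli matrix proportional to `X ^ x Z ^ z`, for the label `(x, z)`. -/
def sigma (e : ZMod 2 × ZMod 2) : Matrix (Fin 2) (Fin 2) ℂ := pauliMatrix (pauliCode e)

theorem pauliCode_surjective : Function.Surjective pauliCode := by decide

theorem sigma_zero_zero : sigma (0, 0) = 1 := by simp [sigma, pauliCode, pauliMatrix]

theorem sigma_zero_one : sigma (0, 1) = !![1, 0; 0, -1] := by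
  simp [sigma, pauliCode, pauliMatrix]

theorem sigma_one_zero : sigma (1, 0) = !![0, 1; 1, 0] := by
  simp [sigma, pauliCode, pauliMatrix]

theorem sigma_one_one : sigma (1, 1) = !![0, -Complex.I; Complex.I, 0] := by
  simp [sigma, pauliCode, pauliMatrix]

theorem sigma_zero : sigma 0 = 1 := sigma_zero_zero

theorem forall_pauliLabel {p : ZMod 2 × ZMod 2 → Prop} (h00 : p (0, 0)) (h01 : p (0, 1))
    (h10 : p (1, 0)) (h11 : p (1, 1)) (e : ZMod 2 × ZMod 2) : p e := by
  have h : ∀ b : ZMod 2, b = 0 ∨ b = 1 := by decide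
  obtain ⟨x, z⟩ := e
  rcases h x with rfl | rfl <;> rcases h z with rfl | rfl <;> assumption

theorem sigma_mul_self (e : ZMod 2 × ZMod 2) : sigma e * sigma e = 1 := by
  revert e
  apply forall_pauliLabel <;>
    simp [sigma_zero_zero, sigma_zero_one, sigma_one_zero, sigma_one_one, Matrix.one_fin_two]

theorem sigma_conjTranspose (e : ZMod 2 × ZMod 2) : (sigma e)ᴴ = sigma e := by
  revert e
  apply forall_pauliLabel <;> ext i j <;> fin_cases i <;> fin_cases j <;>
    simp [sigma_zero_zero, sigma_zero_one, sigma_one_zero, sigma_one_one]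

theorem trace_sigma {e : ZMod 2 × ZMod 2} (he : e ≠ 0) : (sigma e).trace = 0 := by
  revert e
  apply forall_pauliLabel <;>
    simp [sigma_zero_one, sigma_one_zero, sigma_one_one, Matrix.trace, Fin.sum_univ_two]

theorem sigma_mul (e f : ZMod 2 × ZMod 2) :
    ∃ c : ℂ, sigma e * sigma f = c • sigma (e + f) := by
  have h2 : (1 + 1 : ZMod 2) = 0 := by decide
  revert e f
  apply forall_pauliLabel <;> apply forall_pauliLabel
  all_goals
    simp only [Prod.mk_add_mk, zero_add, add_zero, h2, sigma_zero_zero, sigma_zero_one,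
      sigma_one_zero, sigma_one_one, one_mul, mul_one]
    first
      | exact ⟨1, (one_smul _ _).symm⟩
      | (refine ⟨1, ?_⟩; ext i j; fin_cases i <;> fin_cases j <;> simp; done)
      | (refine ⟨-1, ?_⟩; ext i j; fin_cases i <;> fin_cases j <;> simp; done)
      | (refine ⟨Complex.I, ?_⟩; ext i j; fin_cases i <;> fin_cases j <;> simp; done)
      | (refine ⟨-Complex.I, ?_⟩; ext i j; fin_cases i <;> fin_cases j <;> simp)

/-- The Pauli matrix with label `e`, divided by `√2`; as a vector, a Bell state. -/
def bellMatrix (e : ZMod 2 × ZMod 2) : Matrix (Fin 2) (Fin 2) ℂ :=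
  ((Real.sqrt 2 : ℝ) : ℂ)⁻¹ • sigma e

theorem sum_pauliLabel {M : Type*} [AddCommMonoid M] (g : ZMod 2 × ZMod 2 → M) :
    ∑ e, g e = g (0, 0) + g (0, 1) + (g (1, 0) + g (1, 1)) := by
  rw [Fintype.sum_prod_type]
  exact (Fin.sum_univ_two (fun x : Fin 2 => ∑ z : Fin 2, g (x, z))).trans
    (by rw [Fin.sum_univ_two, Fin.sum_univ_two]; rfl)

/-- The Bell states form an orthonormal basis. -/
theorem sum_bellMatrix (i j i' j' : Fin 2) :
    ∑ e, star (bellMatrix e i j) * bellMatrix e i' j' =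
      (1 : Matrix (Fin 2) (Fin 2) ℂ) i i' * (1 : Matrix (Fin 2) (Fin 2) ℂ) j j' := by
  have h2 : ((Real.sqrt 2 : ℝ) : ℂ)⁻¹ * ((Real.sqrt 2 : ℝ) : ℂ)⁻¹ = 1 / 2 := by
    rw [← mul_inv, ← Complex.ofReal_mul, Real.mul_self_sqrt (by norm_num)]; norm_num
  have hterm : ∀ e, star (bellMatrix e i j) * bellMatrix e i' j' =
      1 / 2 * (star (sigma e i j) * sigma e i' j') := fun e => by
    simp only [bellMatrix, Matrix.smul_apply, smul_eq_mul, star_mul', RCLike.star_def, map_inv₀,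
      Complex.conj_ofReal, ← h2]
    ring
  simp only [hterm, sum_pauliLabel, sigma_zero_zero, sigma_zero_one, sigma_one_zero, sigma_one_one]
  fin_cases i <;> fin_cases j <;> fin_cases i' <;> fin_cases j' <;> norm_num

/-- The power `S ^ f` of the phase gate `S = diag(1, i)`. -/
def phaseGate (f : ZMod 2) : Matrix (Fin 2) (Fin 2) ℂ :=
  if f = 0 then 1 else !![1, 0; 0, Complex.I]

/-- The power `(S†) ^ f` of the inverse phase gate. -/
def phaseGateInv (f : ZMod 2) : Matrix (Fin 2) (Fin 2) ℂ :=
  if f = 0 then 1 else !![1, 0; 0, -Complex.I]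

theorem phaseGateInv_mul_phaseGate (f : ZMod 2) : phaseGateInv f * phaseGate f = 1 := by
  unfold phaseGate phaseGateInv
  split_ifs <;> simp [Matrix.one_fin_two]

theorem phaseGateInv_unitary (f : ZMod 2) : (phaseGateInv f)ᴴ * phaseGateInv f = 1 := by
  unfold phaseGateInv
  split_ifs
  · simp
  · ext i j; fin_cases i <;> fin_cases j <;> simp [Matrix.mul_apply, Fin.sum_univ_two]

theorem tGate_unitary : tGateᴴ * tGate = 1 := by
  have h : (starRingEnd ℂ) (Complex.exp (Complex.I * (Real.pi / 4))) *
      Complex.exp (Complex.I * (Real.pi / 4)) = 1 := by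
    rw [← Complex.exp_conj, ← Complex.exp_add]
    rw [← Complex.exp_zero]
    congr 1
    simp only [map_mul, map_div₀, Complex.conj_I, Complex.conj_ofReal, map_ofNat]
    ring
  unfold tGate
  ext i j; fin_cases i <;> fin_cases j <;> simp [Matrix.mul_apply, Fin.sum_univ_two, h]

theorem phaseGateInv_mul_sigma (f : ZMod 2) (e : ZMod 2 × ZMod 2) :
    ∃ c : ℂ, phaseGateInv f * sigma e = c • (sigma (e.1, e.2 + f * e.1) * phaseGateInv f) := by
  have h2 : (1 + 1 : ZMod 2) = 0 := by decide
  have h : ∀ b : ZMod 2, b = 0 ∨ b = 1 := by decide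
  rcases h f with rfl | rfl
  · exact ⟨1, by simp [phaseGateInv]⟩
  · revert e
    have h10 : (1 : ZMod 2) ≠ 0 := by decide
    apply forall_pauliLabel
    all_goals
      simp only [phaseGateInv, h10, if_false, one_mul, mul_one, zero_add, add_zero, h2, mul_zero,
        sigma_zero_zero, sigma_zero_one, sigma_one_zero, sigma_one_one]
      first
        | (refine ⟨1, ?_⟩; ext i j; fin_cases i <;> fin_cases j <;> simp; done)
        | (refine ⟨-1, ?_⟩; ext i j; fin_cases i <;> fin_cases j <;> simp)

/-- Moving a Pauli error through a `T` gate leaves a phase gate exactly when the error has an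
`X` component. -/
theorem tGate_mul_sigma (e : ZMod 2 × ZMod 2) :
    ∃ c : ℂ, tGate * sigma e = c • (phaseGate e.1 * sigma e * tGate) := by
  have h10 : (1 : ZMod 2) ≠ 0 := by decide
  set w := Complex.exp (Complex.I * (Real.pi / 4)) with hw
  have hww : w * w = Complex.I := by
    rw [hw, ← Complex.exp_add, ← mul_add,
      show (Real.pi / 4 + Real.pi / 4 : ℂ) = Real.pi / 2 by ring, mul_comm,
      Complex.exp_pi_div_two_mul_I]
  have hw0 : w ≠ 0 := Complex.exp_ne_zero _
  have hinv : w⁻¹ * (Complex.I) = w := by rw [← hww]; field_simp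
  revert e
  apply forall_pauliLabel
  all_goals
    simp only [phaseGate, tGate, h10, if_false, if_true, one_mul, mul_one, ← hw,
        sigma_zero_zero, sigma_zero_one, sigma_one_zero, sigma_one_one]
  · exact ⟨1, by simp⟩
  · exact ⟨1, by simp⟩
  · exact ⟨w⁻¹, by ext i j; fin_cases i <;> fin_cases j <;> simp [hw0, hinv]⟩
  · refine ⟨w⁻¹, ?_⟩
    ext i j; fin_cases i <;> fin_cases j <;> simp
    · field_simp
    · have h1 : w * Complex.I * w = -1 := by rw [mul_right_comm, hww, Complex.I_mul_I]
      rw [← mul_inv_cancel_right₀ hw0 (w * Complex.I), h1, neg_one_mul]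

/-! ### Products of single-qubit operators and permutations of wires -/

theorem pauliLabel_add_self {ι : Type*} (p : ι → ZMod 2 × ZMod 2) : p + p = 0 := by
  ext i <;> exact CharTwo.add_self_eq_zero _

section WireOp

variable {ι : Type*} [Fintype ι]

theorem qubitTensor_apply (M : ι → Matrix (Fin 2) (Fin 2) ℂ) (r c : ι → Fin 2) :
    qubitTensor M r c = ∏ i, M i (r i) (c i) := rfl

theorem sum_prod_wires [DecidableEq ι] {R : Type*} [CommSemiring R] {κ : Type*} [Fintype κ]
    (g : ι → κ → R) : ∑ s : ι → κ, ∏ i, g i (s i) = ∏ i, ∑ b, g i b := by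
  rw [Finset.prod_univ_sum, Fintype.piFinset_univ]

theorem qubitTensor_mul [DecidableEq ι] (M N : ι → Matrix (Fin 2) (Fin 2) ℂ) :
    qubitTensor M * qubitTensor N = qubitTensor fun i => M i * N i := by
  ext r c
  simp only [Matrix.mul_apply, qubitTensor_apply, ← Finset.prod_mul_distrib]
  exact sum_prod_wires fun i b => M i (r i) b * N i b (c i)

theorem qubitTensor_one [DecidableEq ι] :
    qubitTensor (fun _ : ι => (1 : Matrix (Fin 2) (Fin 2) ℂ)) = 1 := by
  ext r c
  simp only [qubitTensor_apply, Matrix.one_apply, Finset.prod_ite_zero, Finset.prod_const_one,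
    Finset.mem_univ, forall_true_left, funext_iff]

theorem qubitTensor_smul (a : ι → ℂ) (M : ι → Matrix (Fin 2) (Fin 2) ℂ) :
    qubitTensor (fun i => a i • M i) = (∏ i, a i) • qubitTensor M := by
  ext r c
  simp [qubitTensor_apply, Finset.prod_mul_distrib]

theorem qubitTensor_proportional {M N : ι → Matrix (Fin 2) (Fin 2) ℂ}
    (h : ∀ i, ∃ c : ℂ, M i = c • N i) : ∃ c : ℂ, qubitTensor M = c • qubitTensor N := by
  choose c hc using h
  exact ⟨∏ i, c i, by rw [← qubitTensor_smul]; congr 1; exact funext hc⟩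

theorem qubitTensor_conjTranspose (M : ι → Matrix (Fin 2) (Fin 2) ℂ) :
    (qubitTensor M)ᴴ = qubitTensor fun i => (M i)ᴴ := by
  ext r c
  simp [qubitTensor_apply, Matrix.conjTranspose_apply]

theorem trace_qubitTensor [DecidableEq ι] (M : ι → Matrix (Fin 2) (Fin 2) ℂ) :
    (qubitTensor M).trace = ∏ i, (M i).trace :=
  sum_prod_wires fun i b => M i b b

theorem qubitTensor_unitary [DecidableEq ι] {M : ι → Matrix (Fin 2) (Fin 2) ℂ}
    (h : ∀ i, (M i)ᴴ * M i = 1) : (qubitTensor M)ᴴ * qubitTensor M = 1 := by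
  rw [qubitTensor_conjTranspose, qubitTensor_mul]
  simp only [h, qubitTensor_one]

/-- The operator that applies `N i` to wire `i` and then moves wire `i` to position `σ i`. -/
def wireOp (σ : Equiv.Perm ι) (N : ι → Matrix (Fin 2) (Fin 2) ℂ) : QubitOp ι :=
  (qubitTensor N).submatrix (fun r => r ∘ σ) id

theorem wireOp_apply (σ : Equiv.Perm ι) (N : ι → Matrix (Fin 2) (Fin 2) ℂ) (r c : ι → Fin 2) :
    wireOp σ N r c = ∏ i, N i (r (σ i)) (c i) := rfl

theorem wireOp_mul [DecidableEq ι] (σ τ : Equiv.Perm ι) (M N : ι → Matrix (Fin 2) (Fin 2) ℂ) :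
    wireOp σ M * wireOp τ N = wireOp (σ * τ) fun i => M (τ i) * N i := by
  ext r c
  simp only [Matrix.mul_apply, wireOp_apply, Equiv.Perm.mul_apply]
  rw [← (τ.arrowCongr (Equiv.refl (Fin 2))).sum_comp, ← sum_prod_wires]
  refine Fintype.sum_congr _ _ fun s => ?_
  rw [← Equiv.prod_comp τ (fun i => M i (r (σ i)) _), ← Finset.prod_mul_distrib]
  simp [Equiv.arrowCongr]

theorem wireOp_proportional (σ : Equiv.Perm ι) {M N : ι → Matrix (Fin 2) (Fin 2) ℂ}
    (h : ∀ i, ∃ c : ℂ, M i = c • N i) : ∃ c : ℂ, wireOp σ M = c • wireOp σ N := by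
  obtain ⟨c, hc⟩ := qubitTensor_proportional h
  exact ⟨c, by rw [wireOp, hc]; rfl⟩

theorem wireOp_unitary [DecidableEq ι] (σ : Equiv.Perm ι) {N : ι → Matrix (Fin 2) (Fin 2) ℂ}
    (h : ∀ i, (N i)ᴴ * N i = 1) : (wireOp σ N)ᴴ * wireOp σ N = 1 := by
  rw [wireOp, Matrix.conjTranspose_submatrix]
  have := Matrix.submatrix_mul_equiv (qubitTensor N)ᴴ (qubitTensor N) id
    (σ.symm.arrowCongr (Equiv.refl (Fin 2))) id
  simp only [qubitTensor_unitary h, Matrix.submatrix_id_id] at this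
  exact this

/-! ### Pauli strings -/

/-- The Pauli string with label `p`. -/
def pauliString (p : ι → ZMod 2 × ZMod 2) : QubitOp ι := qubitTensor fun i => sigma (p i)

theorem pauliString_conjTranspose (p : ι → ZMod 2 × ZMod 2) : (pauliString p)ᴴ = pauliString p := by
  simp [pauliString, qubitTensor_conjTranspose, sigma_conjTranspose]

theorem pauliString_mem_pauliGroup (p : ι → ZMod 2 × ZMod 2) : pauliString p ∈ pauliGroup ι :=
  ⟨0, fun i => pauliCode (p i), by rw [pow_zero, one_smul]; rfl⟩

theorem exists_pauliString_of_mem_pauliGroup {P : QubitOp ι} (hP : P ∈ pauliGroup ι) :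
    ∃ (c : ℂ) (p : ι → ZMod 2 × ZMod 2), c ≠ 0 ∧ P = c • pauliString p := by
  obtain ⟨k, s, rfl⟩ := hP
  choose p hp using fun i => pauliCode_surjective (s i)
  exact ⟨_, p, pow_ne_zero _ Complex.I_ne_zero, by simp only [← hp]; rfl⟩

variable [DecidableEq ι]

theorem pauliString_mul_self (p : ι → ZMod 2 × ZMod 2) : pauliString p * pauliString p = 1 := by
  simp [pauliString, qubitTensor_mul, sigma_mul_self, qubitTensor_one]

theorem pauliString_ne_zero (p : ι → ZMod 2 × ZMod 2) : pauliString p ≠ 0 := fun h => by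
  simpa [h] using pauliString_mul_self p

theorem pauliString_mul (p q : ι → ZMod 2 × ZMod 2) :
    ∃ c : ℂ, pauliString p * pauliString q = c • pauliString (p + q) := by
  rw [pauliString, pauliString, qubitTensor_mul]
  exact qubitTensor_proportional fun i => sigma_mul (p i) (q i)

theorem pauliString_add (p q : ι → ZMod 2 × ZMod 2) :
    ∃ c : ℂ, pauliString (p + q) = c • (pauliString p * pauliString q) := by
  obtain ⟨c, hc⟩ := pauliString_mul p q
  have hc0 : c ≠ 0 := by
    rintro rfl
    apply pauliString_ne_zero q
    rw [zero_smul] at hc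
    rw [← one_mul (pauliString q), ← pauliString_mul_self p, mul_assoc, hc, mul_zero]
  exact ⟨c⁻¹, by rw [hc, smul_smul, inv_mul_cancel₀ hc0, one_smul]⟩

/-- Distinct Pauli strings are not proportional, since their products have trace zero. -/
theorem pauliString_eq_of_proportional {p q : ι → ZMod 2 × ZMod 2} {c : ℂ}
    (h : pauliString p = c • pauliString q) : p = q := by
  obtain ⟨a, ha⟩ := pauliString_add p q
  rw [h, smul_mul_assoc, pauliString_mul_self, smul_smul] at ha
  by_contra hpq
  obtain ⟨i, hi⟩ := Function.ne_iff.1 hpq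
  have hi' : (p + q) i ≠ 0 := fun h0 => hi <| by
    have : p i + q i = q i + q i := by
      rw [show p i + q i = (p + q) i from rfl, h0]
      exact (congrFun (pauliLabel_add_self q) i).symm
    exact add_right_cancel this
  have htr : (pauliString (p + q)).trace = 0 := by
    rw [pauliString, trace_qubitTensor]
    exact Finset.prod_eq_zero (Finset.mem_univ i) (trace_sigma hi')
  have ha0 : a * c = 0 := by
    rw [ha, Matrix.trace_smul, Matrix.trace_one, smul_eq_mul] at htr
    exact (mul_eq_zero.1 htr).resolve_right (by simp)
  rw [ha0, zero_smul] at ha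
  exact pauliString_ne_zero _ ha

/-- A Clifford unitary acts on Pauli strings, up to phases, by an additive map of their labels. -/
theorem IsClifford.exists_label_hom {C : QubitOp ι} (hC : IsClifford C) :
    ∃ γ : (ι → ZMod 2 × ZMod 2) →+ (ι → ZMod 2 × ZMod 2),
      ∀ p, ∃ c : ℂ, C * pauliString p = c • (pauliString (γ p) * C) := by
  obtain ⟨hU, hP⟩ := hC
  have hU1 : Cᴴ * C = 1 := Matrix.mem_unitaryGroup_iff'.1 hU
  have hU2 : C * Cᴴ = 1 := Matrix.mem_unitaryGroup_iff.1 hU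
  choose c δ hc hδ using fun p =>
    exists_pauliString_of_mem_pauliGroup (hP _ (pauliString_mem_pauliGroup p))
  have hback : ∀ p, pauliString p = c p • (C * pauliString (δ p) * Cᴴ) := fun p => by
    rw [← Matrix.smul_mul, ← Matrix.mul_smul, ← hδ p]
    calc pauliString p = (C * Cᴴ) * pauliString p * (C * Cᴴ) := by rw [hU2, one_mul, mul_one]
      _ = _ := by simp only [mul_assoc]
  have hinj : Function.Injective δ := fun p q hpq => by
    have hq := hback q
    rw [← hpq] at hq
    refine pauliString_eq_of_proportional (c := c p * (c q)⁻¹) ?_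
    rw [hq, hback p, smul_smul, inv_mul_cancel_right₀ (hc q)]
  have hadd : ∀ p q, δ (p + q) = δ p + δ q := fun p q => by
    obtain ⟨a, ha⟩ := pauliString_add p q
    obtain ⟨b, hb⟩ := pauliString_mul (δ p) (δ q)
    refine pauliString_eq_of_proportional (c := (c (p + q))⁻¹ * (a * (c p * c q) * b)) ?_
    have h1 : Cᴴ * (pauliString p * pauliString q) * C =
        (Cᴴ * pauliString p * C) * (Cᴴ * pauliString q * C) := by
      calc _ = Cᴴ * pauliString p * (C * Cᴴ) * pauliString q * C := by
            rw [hU2, mul_one]; simp only [mul_assoc]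
        _ = _ := by simp only [mul_assoc]
    have h2 := hδ (p + q)
    rw [ha, Matrix.mul_smul, Matrix.smul_mul, h1, hδ p, hδ q, smul_mul_smul_comm, hb, smul_smul,
      smul_smul] at h2
    rw [mul_smul, h2, smul_smul, inv_mul_cancel₀ (hc _), one_smul]
  have hbij : Function.Bijective δ := Finite.injective_iff_bijective.1 hinj
  let δe : (ι → ZMod 2 × ZMod 2) ≃+ (ι → ZMod 2 × ZMod 2) :=
    AddEquiv.ofBijective (AddMonoidHom.mk' δ hadd) hbij
  refine ⟨δe.symm.toAddMonoidHom, fun p => ⟨(c (δe.symm p))⁻¹, ?_⟩⟩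
  have hp : δ (δe.symm p) = p := δe.apply_symm_apply p
  have h3 := hback (δe.symm p)
  rw [hp] at h3
  change _ = _ • (pauliString (δe.symm p) * C)
  rw [h3, Matrix.smul_mul, smul_smul, inv_mul_cancel₀ (hc _), one_smul, mul_assoc, hU1, mul_one]

end WireOp

/-! ### Alternating permutation programs -/

section Programs

variable {X Y T : Type*}

/-- `AltProgram k P`: the permutation `P x y` of the state set `T`, depending on the data `x` of
Alice and `y` of Bob, is a product of permutations each depending on the data of one of them, in
which `k` permutations belong to Bob and the permutations of Alice and of Bob alternate. -/
def AltProgram : ℕ → (X → Y → Equiv.Perm T) → Prop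
  | 0, P => ∃ α : X → Equiv.Perm T, ∀ x y, P x y = α x
  | k + 1, P => ∃ (α : X → Equiv.Perm T) (β : Y → Equiv.Perm T) (P' : X → Y → Equiv.Perm T),
      AltProgram k P' ∧ ∀ x y, P x y = α x * β y * P' x y

namespace AltProgram

theorem alice (α : X → Equiv.Perm T) : AltProgram (Y := Y) 0 fun x _ => α x :=
  ⟨α, fun _ _ => rfl⟩

theorem bob (β : Y → Equiv.Perm T) : AltProgram (X := X) 1 fun _ y => β y :=
  ⟨fun _ => 1, β, fun _ _ => 1, ⟨fun _ => 1, fun _ _ => rfl⟩, fun x y => by simp⟩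

theorem alice_mul {k : ℕ} {P : X → Y → Equiv.Perm T} (α : X → Equiv.Perm T)
    (h : AltProgram k P) : AltProgram k fun x y => α x * P x y := by
  cases k with
  | zero =>
    obtain ⟨α', h⟩ := h
    exact ⟨fun x => α x * α' x, fun x y => by simp only [h]⟩
  | succ k =>
    obtain ⟨α', β, P', h', h⟩ := h
    exact ⟨fun x => α x * α' x, β, P', h', fun x y => by simp only [h, mul_assoc]⟩

theorem mul {k l : ℕ} {P P' : X → Y → Equiv.Perm T} (h : AltProgram k P)
    (h' : AltProgram l P') : AltProgram (k + l) fun x y => P x y * P' x y := by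
  induction k generalizing P with
  | zero =>
    obtain ⟨α, h⟩ := h
    simp only [h, zero_add]
    exact alice_mul α h'
  | succ k ih =>
    obtain ⟨α, β, P₁, h₁, h⟩ := h
    rw [Nat.add_right_comm]
    exact ⟨α, β, _, ih h₁, fun x y => by simp only [h, mul_assoc]⟩

theorem mono {k l : ℕ} {P : X → Y → Equiv.Perm T} (h : AltProgram k P) (hkl : k ≤ l) :
    AltProgram l P := by
  induction hkl with
  | refl => exact h
  | step _ ih => exact ⟨fun _ => 1, fun _ => 1, P, ih, fun x y => by simp⟩

theorem inv {k : ℕ} {P : X → Y → Equiv.Perm T} (h : AltProgram k P) :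
    AltProgram k fun x y => (P x y)⁻¹ := by
  induction k generalizing P with
  | zero =>
    obtain ⟨α, h⟩ := h
    exact ⟨fun x => (α x)⁻¹, fun x y => by simp only [h]⟩
  | succ k ih =>
    obtain ⟨α, β, P', h', h⟩ := h
    have h1 : AltProgram 1 fun (x : X) (y : Y) => (β y)⁻¹ * (α x)⁻¹ :=
      mul (bob fun y => (β y)⁻¹) (alice fun x => (α x)⁻¹)
    have := mul (ih h') h1
    simpa only [h, mul_inv_rev] using this

theorem comap {X' Y' : Type*} {k : ℕ} {P : X → Y → Equiv.Perm T} (h : AltProgram k P)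
    (u : X' → X) (v : Y' → Y) : AltProgram k fun x y => P (u x) (v y) := by
  induction k generalizing P with
  | zero =>
    obtain ⟨α, h⟩ := h
    exact ⟨fun x => α (u x), fun x y => h _ _⟩
  | succ k ih =>
    obtain ⟨α, β, P', h', h⟩ := h
    exact ⟨fun x => α (u x), fun y => β (v y), _, ih h', fun x y => h _ _⟩

theorem map {T' : Type*} {k : ℕ} {P : X → Y → Equiv.Perm T} (h : AltProgram k P)
    (φ : Equiv.Perm T →* Equiv.Perm T') : AltProgram k fun x y => φ (P x y) := by
  induction k generalizing P with
  | zero =>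
    obtain ⟨α, h⟩ := h
    exact ⟨fun x => φ (α x), fun x y => by simp only [h]⟩
  | succ k ih =>
    obtain ⟨α, β, P', h', h⟩ := h
    exact ⟨fun x => φ (α x), fun y => φ (β y), _, ih h', fun x y => by simp only [h, map_mul]⟩

end AltProgram

/-- Permutations of `T` act on `T × R` through the first factor. -/
def permProdRight (T R : Type*) : Equiv.Perm T →* Equiv.Perm (T × R) where
  toFun π := π.prodCongr (Equiv.refl R)
  map_one' := rfl
  map_mul' _ _ := rfl

@[simp] theorem permProdRight_apply {R : Type*} (π : Equiv.Perm T) (t : T) (r : R) :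
    permProdRight T R π (t, r) = (π t, r) := rfl

/-- The permutation `(t, a) ↦ (π t, a + e t)`: the error `e t` is added to `a` on the way from `t`
to `π t`. -/
def skewPerm {G : Type*} [AddGroup G] (π : Equiv.Perm T) (e : T → G) : Equiv.Perm (T × G) :=
  (Equiv.prodShear (Equiv.refl T) fun t => Equiv.addRight (e t)).trans (permProdRight T G π)

@[simp] theorem skewPerm_apply {G : Type*} [AddGroup G] (π : Equiv.Perm T) (e : T → G) (t : T)
    (a : G) : skewPerm π e (t, a) = (π t, a + e t) := rfl

theorem skewPerm_mul {G : Type*} [AddGroup G] (π π' : Equiv.Perm T) (e e' : T → G) :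
    skewPerm π e * skewPerm π' e' = skewPerm (π * π') fun t => e' t + e (π' t) := by
  ext ⟨t, a⟩ <;> simp [add_assoc]

/-- `Computes s₀ k f`: an alternating program with `k` permutations of Bob, acting on the states
`S` together with a target bit, adds `f` to the target bit if it is started in the state `s₀`, and
returns to that state. -/
def Computes {S : Type*} (s₀ : S) (k : ℕ) (f : X → Y → ZMod 2) : Prop :=
  ∃ P : X → Y → Equiv.Perm (S × ZMod 2), AltProgram k P ∧
    ∀ x y t, P x y (s₀, t) = (s₀, t + f x y)

namespace Computes

variable {S : Type*} {s₀ : S} {k l : ℕ} {f g : X → Y → ZMod 2}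

theorem bob (s₀ : S) (g : Y → ZMod 2) : Computes (X := X) s₀ 1 fun _ y => g y :=
  ⟨_, AltProgram.bob fun y => skewPerm 1 fun _ => g y, fun _ _ _ => rfl⟩

theorem zero (s₀ : S) : Computes s₀ 0 fun (_ : X) (_ : Y) => 0 :=
  ⟨_, AltProgram.alice fun _ => 1, fun _ _ t => by simp⟩

theorem add (hf : Computes s₀ k f) (hg : Computes s₀ l g) :
    Computes s₀ (k + l) fun x y => f x y + g x y := by
  obtain ⟨P, h, hP⟩ := hf
  obtain ⟨P', h', hP'⟩ := hg
  refine ⟨_, h.mul h', fun x y t => ?_⟩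
  rw [Equiv.Perm.mul_apply, hP', hP, add_assoc, add_comm (g x y)]

theorem mono (hf : Computes s₀ k f) (hkl : k ≤ l) : Computes s₀ l f := by
  obtain ⟨P, h, hP⟩ := hf
  exact ⟨P, h.mono hkl, hP⟩

theorem comap {X' Y' : Type*} (hf : Computes s₀ k f) (u : X' → X) (v : Y' → Y) :
    Computes s₀ k fun x y => f (u x) (v y) := by
  obtain ⟨P, h, hP⟩ := hf
  exact ⟨_, h.comap u v, fun x y t => hP _ _ t⟩

theorem sum {J : Type*} (s : Finset J) {F : J → X → Y → ZMod 2}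
    (h : ∀ j, Computes s₀ k (F j)) : Computes s₀ (s.card * k) fun x y => ∑ j ∈ s, F j x y := by
  classical
  induction s using Finset.induction_on with
  | empty => simpa using zero s₀
  | insert j s hj ih =>
    simp only [Finset.sum_insert hj, Finset.card_insert_of_notMem hj]
    exact (add (h j) ih).mono (by rw [Nat.succ_mul, add_comm])

/-- Additional state may be carried along. -/
theorem prod {R : Type*} (hf : Computes s₀ k f) (r : R) : Computes (s₀, r) k f := by
  obtain ⟨P, h, hP⟩ := hf
  let e : (S × ZMod 2) × R ≃ (S × R) × ZMod 2 :=
    ⟨fun p => ((p.1.1, p.2), p.1.2), fun p => ((p.1.1, p.2), p.1.2), fun _ => rfl, fun _ => rfl⟩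
  refine ⟨_, h.map ((Equiv.permCongrHom e).toMonoidHom.comp (permProdRight _ R)), fun x y t => ?_⟩
  change e (permProdRight _ R (P x y) (e.symm ((s₀, r), t))) = _
  simp [e, hP]

/-- A function of the final state of a program is computed by running the program, copying the value
to the target bit, and running the program backwards. -/
theorem of_altProgram {P : X → Y → Equiv.Perm S} (h : AltProgram k P) (s₀ : S) (g : S → ZMod 2) :
    Computes s₀ (k + k) fun x y => g (P x y s₀) := by
  have h1 := h.map (permProdRight S (ZMod 2))
  refine ⟨_, h1.inv.mul (AltProgram.alice_mul (fun _ => skewPerm 1 g) h1), fun x y t => ?_⟩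
  simp only [Equiv.Perm.mul_apply, permProdRight_apply, skewPerm_apply, Equiv.Perm.one_apply]
  rw [Equiv.Perm.inv_eq_iff_eq]
  simp

end Computes

end Programs

/-! ### Protocols that collect the input on one side -/

section Measurements

/-! A family of operators `E k` with `∑ k, (E k)ᴴ * E k = 1` describes a measurement with outcome
`k`. -/

theorem sum_kronecker_conjTranspose_mul {A B C D κ ν : Type*} [Fintype κ] [Fintype ν]
    [Fintype C] [Fintype D] [DecidableEq A] [DecidableEq B] {E : κ → Matrix C A ℂ}
    {F : κ → ν → Matrix D B ℂ} (hE : ∑ k, (E k)ᴴ * E k = 1)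
    (hF : ∀ k, ∑ l, (F k l)ᴴ * F k l = 1) :
    ∑ p : κ × ν, (E p.1 ⊗ₖ F p.1 p.2)ᴴ * (E p.1 ⊗ₖ F p.1 p.2) = 1 := by
  simp only [Matrix.conjTranspose_kronecker, ← Matrix.mul_kronecker_mul, Fintype.sum_prod_type]
  rw [← Matrix.one_kronecker_one, ← hE]
  ext ⟨a, b⟩ ⟨a', b'⟩
  simp only [Matrix.sum_apply, Matrix.kroneckerMap_apply, ← Finset.mul_sum, Finset.sum_mul]
  refine Fintype.sum_congr _ _ fun k => ?_
  rw [← hF k, Matrix.sum_apply]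

theorem sum_comp_conjTranspose_mul {A B C κ ν : Type*} [Fintype κ] [Fintype ν]
    [Fintype B] [Fintype C] [DecidableEq A] [DecidableEq B] {E : κ → Matrix B A ℂ}
    {F : κ → ν → Matrix C B ℂ} (hE : ∑ k, (E k)ᴴ * E k = 1)
    (hF : ∀ k, ∑ l, (F k l)ᴴ * F k l = 1) :
    ∑ p : κ × ν, (F p.1 p.2 * E p.1)ᴴ * (F p.1 p.2 * E p.1) = 1 := by
  have h : ∀ p : κ × ν, (F p.1 p.2 * E p.1)ᴴ * (F p.1 p.2 * E p.1) =
      (E p.1)ᴴ * ((F p.1 p.2)ᴴ * F p.1 p.2) * E p.1 := fun p => by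
    simp only [Matrix.conjTranspose_mul, Matrix.mul_assoc]
  simp only [h, Fintype.sum_prod_type, ← Matrix.sum_mul, ← Matrix.mul_sum, hF, Matrix.mul_one, hE]

theorem sum_submatrix_conjTranspose_mul {A B C D κ : Type*} [Fintype κ]
    [Fintype C] [Fintype D] [DecidableEq A] [DecidableEq B] {E : κ → Matrix C A ℂ}
    (hE : ∑ k, (E k)ᴴ * E k = 1) (f : D ≃ C) (e : B ≃ A) :
    ∑ k, ((E k).submatrix f e)ᴴ * (E k).submatrix f e = 1 := by
  simp only [Matrix.conjTranspose_submatrix, Matrix.submatrix_mul_equiv]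
  ext i j
  have := congrFun (congrFun hE (e i)) (e j)
  simpa [Matrix.sum_apply, Matrix.one_apply] using this

end Measurements

section Protocols

variable {A B H L X Y : Type*} [DecidableEq A] [DecidableEq B]
  [Fintype H] [Fintype L] [DecidableEq L] [Fintype X] [Fintype Y]

/-- `CollectingProtocol L M`: Alice holds `A` and one half of a maximally entangled state on
`L ⊗ L`, Bob holds the other half and `B`. By a measurement with outcome `x` Alice turns her systems
into `H`, and Bob measures his systems destructively with outcome `y`, in such a way that the input
in `A ⊗ B` is taken to `H` by the operator `M x y`, up to the normalization of the entangled
state. -/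
def CollectingProtocol (L : Type*) [Fintype L] [DecidableEq L]
    (M : X → Y → Matrix H (A × B) ℂ) : Prop :=
  ∃ (E : X → Matrix H (A × L) ℂ) (F : Y → Matrix Unit (L × B) ℂ),
    ∑ x, (E x)ᴴ * E x = 1 ∧ ∑ y, (F y)ᴴ * F y = 1 ∧
      ∀ x y h a b, M x y h (a, b) = ∑ l, E x h (a, l) * F y () (l, b)

/-- A protocol may be continued by Alice and Bob with more entanglement `L'`, each of them taking
into account their own earlier outcome. -/
theorem CollectingProtocol.extend {H' L' X' Y' : Type*} [Fintype H'] [Fintype L'] [DecidableEq L']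
    [DecidableEq H] [Fintype X'] [Fintype Y'] {M : X → Y → Matrix H (A × B) ℂ}
    (hM : CollectingProtocol L M) {D : X → X' → Matrix H' (H × L') ℂ}
    (hD : ∀ x, ∑ x', (D x x')ᴴ * D x x' = 1) {G : Y → Y' → Matrix Unit L' ℂ}
    (hG : ∀ y, ∑ y', (G y y')ᴴ * G y y' = 1) :
    CollectingProtocol (L × L') fun (p : X × X') (q : Y × Y') =>
      (Matrix.of fun h' h => ∑ l', D p.1 p.2 h' (h, l') * G q.1 q.2 () l') * M p.1 q.1 := by
  obtain ⟨E, F, hE, hF, h⟩ := hM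
  let e₁ : Unit ≃ Unit × Unit := (Equiv.prodPUnit Unit).symm
  let e₂ : (L × L') × B ≃ (L × B) × L' :=
    ⟨fun r => ((r.1.1, r.2), r.1.2), fun r => ((r.1.1, r.2), r.1.2), fun _ => rfl, fun _ => rfl⟩
  refine ⟨fun p => (D p.1 p.2 * (E p.1 ⊗ₖ (1 : Matrix L' L' ℂ))).submatrix (Equiv.refl H')
      (Equiv.prodAssoc A L L').symm, fun q => (F q.1 ⊗ₖ G q.1 q.2).submatrix e₁ e₂, ?_, ?_, ?_⟩
  · refine sum_submatrix_conjTranspose_mul (sum_comp_conjTranspose_mul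
      (E := fun x => E x ⊗ₖ (1 : Matrix L' L' ℂ)) ?_ hD) _ _
    have := sum_kronecker_conjTranspose_mul (ν := Unit) (F := fun _ _ => (1 : Matrix L' L' ℂ)) hE
      (by simp)
    simpa only [Fintype.sum_prod_type, Finset.univ_unique, Finset.sum_singleton] using this
  · exact sum_submatrix_conjTranspose_mul (sum_kronecker_conjTranspose_mul hF hG) _ _
  · rintro ⟨x, x'⟩ ⟨y, y'⟩ h' a b
    simp only [Matrix.mul_apply, Matrix.of_apply, h, Matrix.submatrix_apply,
      Matrix.kroneckerMap_apply, Equiv.coe_refl, id, Equiv.prodAssoc_symm_apply,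
      Fintype.sum_prod_type, Matrix.one_apply, mul_ite, mul_one, mul_zero, Finset.sum_ite_eq',
      Finset.mem_univ, if_true, Finset.sum_mul, Finset.mul_sum]
    rw [Finset.sum_comm]
    refine Fintype.sum_congr _ _ fun l => ?_
    rw [Finset.sum_comm]
    refine Fintype.sum_congr _ _ fun l' => Fintype.sum_congr _ _ fun k => ?_
    change _ = D x x' h' (k, l') * E x k (a, l) * (F y () (l, b) * G y y' () l')
    ring

/-- Alice may apply a measurement depending on her earlier outcome. -/
theorem CollectingProtocol.alice {H' X' : Type*} [Fintype H'] [DecidableEq H] [Fintype X']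
    {M : X → Y → Matrix H (A × B) ℂ} (hM : CollectingProtocol L M) {D : X → X' → Matrix H' H ℂ}
    (hD : ∀ x, ∑ x', (D x x')ᴴ * D x x' = 1) :
    CollectingProtocol L fun (p : X × X') y => D p.1 p.2 * M p.1 y := by
  obtain ⟨E, F, hE, hF, h⟩ := hM
  refine ⟨fun p => D p.1 p.2 * E p.1, F, sum_comp_conjTranspose_mul hE hD, hF, ?_⟩
  rintro ⟨x, x'⟩ y h' a b
  simp only [Matrix.mul_apply, h, Finset.sum_mul, Finset.mul_sum, mul_assoc]
  exact Finset.sum_comm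

/-- Alice may apply an isometry depending on her earlier outcome. -/
theorem CollectingProtocol.isometry {H' : Type*} [Fintype H'] [DecidableEq H]
    {M : X → Y → Matrix H (A × B) ℂ} (hM : CollectingProtocol L M) {D : X → Matrix H' H ℂ}
    (hD : ∀ x, (D x)ᴴ * D x = 1) : CollectingProtocol L fun x y => D x * M x y := by
  obtain ⟨E, F, hE, hF, h⟩ := hM
  refine ⟨fun x => D x * E x, F, ?_, hF, ?_⟩
  · rw [← hE]
    refine Fintype.sum_congr _ _ fun x => ?_
    rw [Matrix.conjTranspose_mul, Matrix.mul_assoc, ← Matrix.mul_assoc _ (D x), hD, Matrix.one_mul]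
  · intro x y h' a b
    simp only [Matrix.mul_apply, h, Finset.sum_mul, Finset.mul_sum, mul_assoc]
    exact Finset.sum_comm

/-! ### Teleportation -/

section Teleportation

variable {ι : Type*} [Fintype ι]

/-- A product of Bell states between corresponding wires, as a matrix. -/
def bellTensor (o : ι → ZMod 2 × ZMod 2) : QubitOp ι := qubitTensor fun i => bellMatrix (o i)

/-- Bell measurements are complete. -/
theorem sum_bellTensor [DecidableEq ι] (r c r' c' : ι → Fin 2) :
    ∑ o, star (bellTensor o r c) * bellTensor o r' c' =
      (1 : QubitOp ι) r r' * (1 : QubitOp ι) c c' := by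
  simp only [bellTensor, qubitTensor_apply, star_prod, ← Finset.prod_mul_distrib]
  rw [sum_prod_wires fun i e => star (bellMatrix e (r i) (c i)) * bellMatrix e (r' i) (c' i)]
  simp only [sum_bellMatrix, Finset.prod_mul_distrib, ← qubitTensor_one (ι := ι), qubitTensor_apply]

variable [DecidableEq ι]

/-- Alice teleports all her wires to Bob, who rearranges them by a permutation of his choice and
teleports them back. Each wire acquires a Pauli error, which is the sum of a term known to Alice and
a term known to Bob. -/
theorem CollectingProtocol.bob_permutes {M : X → Y → Matrix (ι → Fin 2) (A × B) ℂ}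
    (hM : CollectingProtocol L M) (β : Y → Equiv.Perm ι) :
    ∃ M' : X × (ι → ZMod 2 × ZMod 2) → Y × (ι → ZMod 2 × ZMod 2) → Matrix (ι → Fin 2) (A × B) ℂ,
      CollectingProtocol (L × (ι → Fin 2) × (ι → Fin 2)) M' ∧
      ∀ p q, ∃ c : ℂ, M' p q =
        c • (wireOp (β q.1) (fun i => sigma (p.2 i + q.2 i)) * M p.1 q.1) := by
  -- Alice's measurement consumes her wires and her halves of the first group of pairs; the wires
  -- reappear as her halves of the second group.
  let D : (ι → ZMod 2 × ZMod 2) →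
      Matrix (ι → Fin 2) ((ι → Fin 2) × (ι → Fin 2) × (ι → Fin 2)) ℂ :=
    fun o => Matrix.of fun r s => bellTensor o s.2.1 s.1 * (1 : QubitOp ι) r s.2.2
  -- Bob connects pair `i` of the first group to pair `β y i` of the second by a Bell measurement.
  let G : Y → (ι → ZMod 2 × ZMod 2) → Matrix Unit ((ι → Fin 2) × (ι → Fin 2)) ℂ :=
    fun y o => Matrix.of fun _ s => bellTensor o (s.2 ∘ β y) s.1
  have hD : ∑ o, (D o)ᴴ * D o = 1 := by
    ext ⟨c, l, r⟩ ⟨c', l', r'⟩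
    simp only [D, Matrix.sum_apply, Matrix.mul_apply, Matrix.conjTranspose_apply, Matrix.of_apply]
    rw [Finset.sum_comm]
    have h : ∀ s o, star (bellTensor o l c * (1 : QubitOp ι) s r) *
        (bellTensor o l' c' * (1 : QubitOp ι) s r') = 
        (star (bellTensor o l c) * bellTensor o l' c') *
          ((1 : QubitOp ι) s r' * star ((1 : QubitOp ι) s r)) := fun s o => by
      rw [star_mul']; ring
    simp only [h, ← Finset.sum_mul, sum_bellTensor]
    have h1 : ∀ s, star ((1 : QubitOp ι) s r) = (1 : QubitOp ι) r s := fun s => by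
      rw [← Matrix.conjTranspose_apply, Matrix.conjTranspose_one]
    have h2 := Matrix.mul_apply (M := (1 : QubitOp ι)) (N := 1) (i := r) (k := r')
    simp only [h1, ← Finset.mul_sum, mul_comm ((1 : QubitOp ι) _ r'), ← h2, mul_one]
    simp only [← Matrix.one_kronecker_one, Matrix.kroneckerMap_apply]
    ring
  have hG : ∀ y, ∑ o, (G y o)ᴴ * G y o = 1 := fun y => by
    ext ⟨l, r⟩ ⟨l', r'⟩
    simp only [G, Matrix.sum_apply, Matrix.mul_apply, Matrix.conjTranspose_apply, Matrix.of_apply,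
      Finset.univ_unique, Finset.sum_singleton, sum_bellTensor]
    have h : (1 : QubitOp ι) (r ∘ β y) (r' ∘ β y) = (1 : QubitOp ι) r r' := by
      simp only [Matrix.one_apply, (β y).surjective.injective_comp_right.eq_iff]
    rw [h, ← Matrix.one_kronecker_one, Matrix.kroneckerMap_apply, mul_comm]
  refine ⟨_, hM.extend (fun _ => hD) hG, ?_⟩
  rintro ⟨x, o⟩ ⟨y, o'⟩
  have h : (Matrix.of fun r c => ∑ s, D o r (c, s) * G y o' () s) =
      wireOp (β y) fun i => bellMatrix (o' i) * bellMatrix (o i) := by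
    rw [wireOp, ← qubitTensor_mul]
    ext r c
    simp only [D, G, Matrix.of_apply, Matrix.submatrix_apply, Matrix.mul_apply, id,
      Fintype.sum_prod_type, Matrix.one_apply, mul_ite, ite_mul, mul_one, mul_zero, zero_mul,
      Finset.sum_ite_eq, Finset.mem_univ, if_true]
    exact Fintype.sum_congr _ _ fun l => mul_comm _ _
  have h' : ∀ i, ∃ c : ℂ, bellMatrix (o' i) * bellMatrix (o i) = c • sigma (o i + o' i) :=
    fun i => by
      obtain ⟨c, hc⟩ := sigma_mul (o' i) (o i)
      rw [bellMatrix, bellMatrix, smul_mul_smul_comm, hc, smul_smul, add_comm]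
      exact ⟨_, rfl⟩
  obtain ⟨c, hc⟩ := wireOp_proportional (β y) h'
  exact ⟨c, by simp only [h, hc, Matrix.smul_mul]⟩

end Teleportation

end Protocols

/-- Bob may teleport his input qubits to Alice; the Pauli errors are known to him. -/
theorem collectingProtocol_teleport {α β : Type*} [Fintype α] [DecidableEq α] [Fintype β]
    [DecidableEq β] :
    ∃ M : Unit → (β → ZMod 2 × ZMod 2) →
        Matrix (α ⊕ β → Fin 2) ((α → Fin 2) × (β → Fin 2)) ℂ,
      CollectingProtocol (β → Fin 2) M ∧
      ∀ x y, ∃ c : ℂ, M x y = c • (pauliString (Sum.elim (fun _ => 0) y)).submatrix id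
        (fun p => Sum.elim p.1 p.2) := by
  let M : Unit → (β → ZMod 2 × ZMod 2) →
        Matrix (α ⊕ β → Fin 2) ((α → Fin 2) × (β → Fin 2)) ℂ := fun _ y =>
    (qubitTensor (Sum.elim (fun _ => 1) fun i => bellMatrix (y i))).submatrix id
        (fun p => Sum.elim p.1 p.2)
  refine ⟨M, ⟨fun _ => Matrix.of fun h s => (1 : QubitOp (α ⊕ β)) h (Sum.elim s.1 s.2),
    fun y => Matrix.of fun _ s => bellTensor y s.1 s.2, ?_, ?_, ?_⟩, fun x y => ?_⟩
  · exact sum_submatrix_conjTranspose_mul (κ := Unit) (E := fun _ => (1 : QubitOp (α ⊕ β)))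
      (by simp) (Equiv.refl _) (Equiv.sumArrowEquivProdArrow α β (Fin 2)).symm
  · ext ⟨l, b⟩ ⟨l', b'⟩
    simp only [Matrix.sum_apply, Matrix.mul_apply, Matrix.conjTranspose_apply, Matrix.of_apply,
      Finset.univ_unique, Finset.sum_singleton, sum_bellTensor]
    rw [← Matrix.one_kronecker_one, Matrix.kroneckerMap_apply]
  · intro x y h a b
    simp only [M, Matrix.submatrix_apply, id, Matrix.of_apply, qubitTensor_apply,
      ← qubitTensor_one, Fintype.prod_sum_type, Sum.elim_inl, Sum.elim_inr, mul_assoc]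
    have h1 := congrFun (congrFun (one_mul (bellTensor y)) fun i => h (Sum.inr i)) b
    rw [← qubitTensor_one, Matrix.mul_apply] at h1
    exact (congrArg (_ * ·) h1.symm).trans (Finset.mul_sum _ _ _)
  · have h : ∀ i : α ⊕ β, ∃ c : ℂ, (Sum.elim (fun _ => 1) fun i => bellMatrix (y i) :
        α ⊕ β → Matrix (Fin 2) (Fin 2) ℂ) i = 
          c • sigma ((Sum.elim (fun _ => 0) y : α ⊕ β → ZMod 2 × ZMod 2) i) := by
      rintro (i | i)
      · exact ⟨1, by simp [sigma_zero]⟩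
      · exact ⟨_, rfl⟩
    obtain ⟨c, hc⟩ := qubitTensor_proportional h
    exact ⟨c, by simp only [M, hc]; rfl⟩

/-! ### Routing qubits through alternating programs -/

/-- The permutation of the wires `J × T` acting as `π j` on the block with label `j`. -/
def blockPerm {J T : Type*} (π : J → Equiv.Perm T) : Equiv.Perm (J × T) :=
  Equiv.prodShear (Equiv.refl J) π

@[simp] theorem blockPerm_apply {J T : Type*} (π : J → Equiv.Perm T) (w : J × T) :
    blockPerm π w = (w.1, π w.1 w.2) := rfl

theorem blockPerm_mul {J T : Type*} (π π' : J → Equiv.Perm T) :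
    blockPerm π * blockPerm π' = blockPerm fun j => π j * π' j := rfl

section Routing

variable {A B L X Y : Type} [DecidableEq A] [DecidableEq B]
  [Fintype L] [DecidableEq L] [Fintype X] [Fintype Y]

/-- Alice and Bob can route qubits, held by Alice, through alternating programs whose states label
wires. The Pauli errors that accumulate along the way are tracked by programs of the same length. -/
theorem CollectingProtocol.route {J T : Type} [Fintype J] [DecidableEq J] [Fintype T]
    [DecidableEq T] {M : X → Y → Matrix (J × T → Fin 2) (A × B) ℂ} (hM : CollectingProtocol L M)
    {m : ℕ} (hL : Fintype.card L = 2 ^ m) {k : ℕ} {P : J → X → Y → Equiv.Perm T}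
    (hP : ∀ j, AltProgram k (P j)) :
    ∃ (L' X' Y' : Type) (_ : Fintype L') (_ : DecidableEq L') (_ : Fintype X') (_ : Fintype Y')
      (u : X' → X) (v : Y' → Y) (M' : X' → Y' → Matrix (J × T → Fin 2) (A × B) ℂ)
      (e : J → X' → Y' → T → ZMod 2 × ZMod 2),
      CollectingProtocol L' M' ∧
      Fintype.card L' = 2 ^ (m + 2 * (Fintype.card J * Fintype.card T) * k) ∧
      (∀ x y, ∃ c : ℂ, M' x y = c • (wireOp (blockPerm fun j => P j (u x) (v y))
        (fun w => sigma (e w.1 x y w.2)) * M (u x) (v y))) ∧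
      ∀ j, AltProgram k fun x y => skewPerm (P j (u x) (v y)) (e j x y) := by
  induction k generalizing P with
  | zero =>
    choose α hα using hP
    refine ⟨L, X, Y, inferInstance, inferInstance, inferInstance, inferInstance, id, id, _,
      fun _ _ _ _ => 0, hM.isometry (D := fun x => wireOp (blockPerm fun j => α j x) fun _ => 1)
      (fun x => wireOp_unitary _ (by simp)), by simpa using hL, fun x y => ⟨1, ?_⟩, fun j => ?_⟩
    · simp only [id, hα, sigma_zero, one_smul]
    · simp only [id, hα]
      exact AltProgram.alice _
  | succ k ih =>
    choose α β P' hP' hP using hP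
    obtain ⟨L', X', Y', _, _, _, _, u, v, M', e, hM', hL', hMe, he⟩ := ih hP'
    obtain ⟨M'', hM'', hMo⟩ := hM'.bob_permutes fun y => blockPerm fun j => β j (v y)
    refine ⟨_, _, _, inferInstance, inferInstance, inferInstance, inferInstance,
      fun p => u p.1, fun q => v q.1, _,
      fun j p q t => e j p.1 q.1 t + (p.2 (j, P' j (u p.1) (v q.1) t) +
        q.2 (j, P' j (u p.1) (v q.1) t)),
      hM''.isometry (D := fun p => wireOp (blockPerm fun j => α j (u p.1)) fun _ => 1)
      (fun x => wireOp_unitary _ (by simp)), ?_, fun p q => ?_, fun j => ?_⟩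
    · simp only [Fintype.card_prod, hL', Fintype.card_fun, Fintype.card_fin, ← pow_add]
      congr 1
      ring
    · obtain ⟨c, hc⟩ := hMo p q
      obtain ⟨c', hc'⟩ := hMe p.1 q.1
      rw [hc, hc']
      simp only [Matrix.mul_smul, ← Matrix.mul_assoc, wireOp_mul, blockPerm_mul, hP, one_mul,
        ← mul_assoc, smul_smul]
      obtain ⟨a, ha⟩ := wireOp_proportional
        (blockPerm fun j => α j (u p.1) * β j (v q.1) * P' j (u p.1) (v q.1))
        (M := fun w => sigma (p.2 (blockPerm (fun j => P' j (u p.1) (v q.1)) w) +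
          q.2 (blockPerm (fun j => P' j (u p.1) (v q.1)) w)) * sigma (e w.1 p.1 q.1 w.2))
        (fun w => sigma_mul _ _)
      rw [ha, Matrix.smul_mul, smul_smul]
      refine ⟨_, congrArg _ (congrArg (· * _) (congrArg _ (funext fun w => ?_)))⟩
      rw [add_comm]
      rfl
    · -- The new errors are picked up when wires arrive, before Bob permutes them; the part known
      -- to Alice is added by her preceding permutation.
      refine ⟨fun p => skewPerm (α j (u p.1)) 0,
        fun q => skewPerm (β j (v q.1)) fun t => q.2 (j, t),
        fun p q => skewPerm 1 (fun t => p.2 (j, t)) *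
          skewPerm (P' j (u p.1) (v q.1)) (e j p.1 q.1),
        AltProgram.alice_mul _ ((he j).comap Prod.fst Prod.fst), fun p q => ?_⟩
      simp only [skewPerm_mul, hP, mul_assoc, one_mul]
      congr 1
      funext t
      simp [add_assoc]

end Routing

section Junk

variable {J T : Type*} [DecidableEq T]

/-- Assignments of bits to the wires `J × T` consist of assignments to the data wires `(j, t₀)` and
to the other wires. -/
def wireSplit (t₀ : T) :
    (J → Fin 2) × ({w : J × T // w.2 ≠ t₀} → Fin 2) ≃ (J × T → Fin 2) where
  toFun p w := if h : w.2 = t₀ then p.1 w.1 else p.2 ⟨w, h⟩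
  invFun r := (fun j => r (j, t₀), fun w => r w)
  left_inv p := by
    refine Prod.ext (funext fun j => by simp) (funext fun w => ?_)
    simp [w.2]
  right_inv r := by
    funext ⟨j, t⟩
    by_cases h : t = t₀
    · subst h; simp
    · simp [h]

variable [Fintype J] [DecidableEq J] [Fintype T]

/-- The isometry that places qubits on the data wires `(j, t₀)`, the other wires being `|0⟩`. -/
def loadWires (t₀ : T) : Matrix (J × T → Fin 2) (J → Fin 2) ℂ :=
  (1 : QubitOp (J × T)).submatrix id fun c => wireSplit t₀ (c, 0)

/-- The measurement operators of the measurement of all wires except the data wires `(j, t₀)`, in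
the computational basis. -/
def unloadWires (t₀ : T) (z : {w : J × T // w.2 ≠ t₀} → Fin 2) :
    Matrix (J → Fin 2) (J × T → Fin 2) ℂ :=
  (1 : QubitOp (J × T)).submatrix (fun c => wireSplit t₀ (c, z)) id

theorem loadWires_isometry (t₀ : T) :
    (loadWires t₀ : Matrix (J × T → Fin 2) (J → Fin 2) ℂ)ᴴ * loadWires (J := J) t₀ = 1 := by
  ext c c'
  simp [loadWires, Matrix.mul_apply, Matrix.one_apply]

theorem sum_unloadWires (t₀ : T) :
    ∑ z : {w : J × T // w.2 ≠ t₀} → Fin 2, (unloadWires t₀ z)ᴴ * unloadWires t₀ z = 1 := by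
  ext r r'
  have h := congrFun (congrFun (mul_one ((1 : QubitOp (J × T))ᴴ)) r) r'
  rw [Matrix.mul_apply, ← (wireSplit t₀).sum_comp, Fintype.sum_prod_type_right,
    Matrix.conjTranspose_one] at h
  rw [← h, Matrix.sum_apply]
  refine Fintype.sum_congr _ _ fun z => ?_
  rw [Matrix.mul_apply]
  refine Fintype.sum_congr _ _ fun c => ?_
  rw [Matrix.conjTranspose_apply, ← Matrix.conjTranspose_apply _ _ r]
  simp [unloadWires, Matrix.one_apply, eq_comm]

/-- Wires other than the data wires do not matter for the data, if the data return to the data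
wires. -/
theorem unload_wireOp_load {t₀ : T} {π : J → Equiv.Perm T} (hπ : ∀ j, π j t₀ = t₀)
    (N : J × T → Matrix (Fin 2) (Fin 2) ℂ) (z : {w : J × T // w.2 ≠ t₀} → Fin 2) :
    ∃ c : ℂ, unloadWires t₀ z * (wireOp (blockPerm π) N * loadWires (J := J) t₀) =
      c • qubitTensor fun j => N (j, t₀) := by
  -- The constant is the product of the amplitudes of the wires that carry no data; it may vanish.
  refine ⟨∏ j, ∏ t ∈ Finset.univ.erase t₀, N (j, t) (wireSplit t₀ (0, z) (j, π j t)) 0, ?_⟩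
  have h : unloadWires t₀ z * (wireOp (blockPerm π) N * loadWires (J := J) t₀) =
      (wireOp (blockPerm π) N).submatrix (fun c => wireSplit t₀ (c, z))
        fun c => wireSplit t₀ (c, 0) := by
    ext r c
    simp [unloadWires, loadWires, Matrix.mul_apply, Matrix.one_apply]
  rw [h]
  ext r c
  rw [Matrix.submatrix_apply, wireOp_apply, Fintype.prod_prod_type, Matrix.smul_apply, smul_eq_mul,
    qubitTensor_apply, mul_comm, ← Finset.prod_mul_distrib]
  refine Fintype.prod_congr _ _ fun j => ?_
  rw [← Finset.mul_prod_erase _ _ (Finset.mem_univ t₀)]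
  congr 1
  · simp [wireSplit, hπ]
  · refine Finset.prod_congr rfl fun t ht => ?_
    have ht : t ≠ t₀ := Finset.ne_of_mem_erase ht
    have ht' : π j t ≠ t₀ := fun h => ht ((π j).injective (h.trans (hπ j).symm))
    simp [wireSplit, ht, ht']

end Junk

/-! ### Removing phase errors -/

/-- The effect on Pauli labels of conjugation by `(S†) ^ b`. -/
def phaseShear (b : ZMod 2) : Equiv.Perm (ZMod 2 × ZMod 2) :=
  Equiv.prodShear (Equiv.refl _) fun x => Equiv.addRight (b * x)

theorem phaseShear_apply (b : ZMod 2) (e : ZMod 2 × ZMod 2) :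
    phaseShear b e = (e.1, e.2 + b * e.1) := rfl

section Correction

variable {A B L X Y ι S : Type} [DecidableEq A] [DecidableEq B]
  [Fintype L] [DecidableEq L] [Fintype X] [Fintype Y]
  [Fintype ι] [DecidableEq ι] [Fintype S] [DecidableEq S]

/-- Each qubit is routed to a wire that shows whether it carries a phase error, the inverse phase
gate is applied to all wires that show an error, and the qubit is routed back. The new Pauli
errors are tracked by the program that does the same with a Pauli label. -/
theorem CollectingProtocol.remove_phases {M : X → Y → Matrix (ι → Fin 2) (A × B) ℂ}
    (hM : CollectingProtocol L M) {m : ℕ} (hL : Fintype.card L = 2 ^ m) {k : ℕ} {s₀ : S}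
    {f : ι → X → Y → ZMod 2} (hf : ∀ j, Computes s₀ k (f j)) :
    ∃ (L' X' Y' : Type) (_ : Fintype L') (_ : DecidableEq L') (_ : Fintype X') (_ : Fintype Y')
      (u : X' → X) (v : Y' → Y) (M' : X' → Y' → Matrix (ι → Fin 2) (A × B) ℂ)
      (e : ι → X' → Y' → ZMod 2 × ZMod 2),
      CollectingProtocol L' M' ∧
      Fintype.card L' = 2 ^ (m + 8 * (Fintype.card ι * Fintype.card S) * k) ∧
      (∀ x y, ∃ c : ℂ, M' x y = c • (qubitTensor (fun j => sigma (e j x y) *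
        phaseGateInv (f j (u x) (v y))) * M (u x) (v y))) ∧
      ∀ j (g : ZMod 2 × ZMod 2 → ZMod 2),
        Computes ((s₀, (0 : ZMod 2)), (0 : ZMod 2 × ZMod 2)) (4 * k) fun x y => g (e j x y) := by
  choose P hP hPf using hf
  have h2 : Fintype.card (ZMod 2) = 2 := rfl
  have hM1 := hM.isometry (D := fun _ => loadWires (s₀, (0 : ZMod 2)))
    (fun _ => loadWires_isometry _)
  obtain ⟨L2, X2, Y2, _, _, _, _, u2, v2, M2, e2, hM2, hL2, hMe2, he2⟩ := hM1.route hL hP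
  have hM3 := hM2.isometry
    (D := fun _ => wireOp 1 fun w : ι × S × ZMod 2 => phaseGateInv w.2.2)
    (fun _ => wireOp_unitary _ fun _ => phaseGateInv_unitary _)
  obtain ⟨L4, X4, Y4, _, _, _, _, u4, v4, M4, e4, hM4, hL4, hMe4, he4⟩ :=
    hM3.route hL2 fun j => (hP j).comap u2 v2
  have hM5 := hM4.alice (fun _ => sum_unloadWires (J := ι) (s₀, (0 : ZMod 2)))
  -- The error of the first run passes through the inverse phase gate; that of the second run starts
  -- at the wire with target bit `f j`, where the qubit then is.
  let e : ι → X4 → Y4 → ZMod 2 × ZMod 2 := fun j x y =>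
    phaseShear (f j (u2 (u4 x)) (v2 (v4 y))) (e2 j (u4 x) (v4 y) (s₀, 0)) +
      e4 j x y (s₀, f j (u2 (u4 x)) (v2 (v4 y)))
  refine ⟨L4, _, Y4, inferInstance, inferInstance, inferInstance, inferInstance,
    fun p => u2 (u4 p.1), fun y => v2 (v4 y), _, fun j p => e j p.1, hM5, ?_, ?_, fun j g => ?_⟩
  · rw [hL4]
    simp only [Fintype.card_prod, h2]
    congr 1
    ring
  · rintro ⟨x, z⟩ y
    obtain ⟨c2, h2⟩ := hMe2 (u4 x) (v4 y)
    obtain ⟨c4, h4⟩ := hMe4 x y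
    -- The two runs cancel in characteristic two, so that the data qubits return.
    have hret : ∀ j, (P j (u2 (u4 x)) (v2 (v4 y)) * P j (u2 (u4 x)) (v2 (v4 y))) (s₀, 0) =
        (s₀, 0) := fun j => by
      rw [Equiv.Perm.mul_apply, hPf, hPf, zero_add, CharTwo.add_self_eq_zero]
    obtain ⟨c, hc⟩ := unload_wireOp_load hret (fun w =>
      sigma (e4 w.1 x y (P w.1 (u2 (u4 x)) (v2 (v4 y)) w.2)) *
        (phaseGateInv (P w.1 (u2 (u4 x)) (v2 (v4 y)) w.2).2 *
          sigma (e2 w.1 (u4 x) (v4 y) w.2))) z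
    have hN : ∀ j, ∃ a : ℂ, sigma (e4 j x y (P j (u2 (u4 x)) (v2 (v4 y)) (s₀, 0))) *
        (phaseGateInv (P j (u2 (u4 x)) (v2 (v4 y)) (s₀, 0)).2 *
          sigma (e2 j (u4 x) (v4 y) (s₀, 0))) =
        a • (sigma (e j x y) * phaseGateInv (f j (u2 (u4 x)) (v2 (v4 y)))) := fun j => by
      rw [hPf, zero_add]
      obtain ⟨a, ha⟩ := phaseGateInv_mul_sigma (f j (u2 (u4 x)) (v2 (v4 y)))
        (e2 j (u4 x) (v4 y) (s₀, 0))
      obtain ⟨b, hb⟩ := sigma_mul (e4 j x y (s₀, f j (u2 (u4 x)) (v2 (v4 y))))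
        (phaseShear (f j (u2 (u4 x)) (v2 (v4 y))) (e2 j (u4 x) (v4 y) (s₀, 0)))
      refine ⟨a * b, ?_⟩
      rw [ha, Matrix.mul_smul, ← Matrix.mul_assoc, ← phaseShear_apply, hb, Matrix.smul_mul,
        smul_smul, add_comm]
    obtain ⟨a, ha⟩ := qubitTensor_proportional hN
    refine ⟨c4 * c2 * (c * a), ?_⟩
    have key : wireOp (blockPerm fun j => P j (u2 (u4 x)) (v2 (v4 y)))
          (fun w => sigma (e4 w.1 x y w.2)) *
        (wireOp 1 (fun w : ι × S × ZMod 2 => phaseGateInv w.2.2) *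
          wireOp (blockPerm fun j => P j (u2 (u4 x)) (v2 (v4 y)))
            (fun w => sigma (e2 w.1 (u4 x) (v4 y) w.2))) = wireOp (blockPerm fun j =>
        P j (u2 (u4 x)) (v2 (v4 y)) * P j (u2 (u4 x)) (v2 (v4 y))) (fun w =>
      sigma (e4 w.1 x y (P w.1 (u2 (u4 x)) (v2 (v4 y)) w.2)) *
        (phaseGateInv (P w.1 (u2 (u4 x)) (v2 (v4 y)) w.2).2 *
          sigma (e2 w.1 (u4 x) (v4 y) w.2))) := by
      rw [wireOp_mul, wireOp_mul]
      rfl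
    rw [h4, h2]
    rw [ha, smul_smul, ← key] at hc
    simp only [Matrix.mul_smul, smul_smul]
    rw [mul_smul (c4 * c2), ← Matrix.smul_mul (c * a), ← hc]
    simp only [Matrix.mul_assoc]
  · let K : Equiv.Perm ((S × ZMod 2) × ZMod 2 × ZMod 2) :=
      Equiv.prodShear (Equiv.refl _) fun t => phaseShear t.2
    have h := (he4 j).mul (AltProgram.alice_mul (fun _ => K) ((he2 j).comap u4 v4))
    have h' := ((Computes.of_altProgram h ((s₀, 0), 0) fun r => g r.2).mono
      (show k + k + (k + k) ≤ 4 * k by omega)).comap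
        (Prod.fst : X4 × ({w : ι × S × ZMod 2 // w.2 ≠ (s₀, 0)} → Fin 2) → X4) (id : Y4 → Y4)
    convert h' using 4 with p y
    simp only [Equiv.Perm.mul_apply, skewPerm_apply, hPf, K, Equiv.prodShear_apply, e, zero_add, id,
      Equiv.refl_apply]

end Correction

/-! ### Clifford+T circuits on encrypted data -/

section Circuits

variable {α β S : Type} [Fintype α] [DecidableEq α] [Fintype β] [DecidableEq β]

/-- With `m` EPR pairs, Alice collects the output of the circuit `V`, up to a Pauli error each of
whose linear functionals is computed by a program with states `S` and `k` permutations of Bob. -/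
def CollectsUpToPauli (m : ℕ) (s₀ : S) (k : ℕ) (V : QubitOp (α ⊕ β)) : Prop :=
  ∃ (L X Y : Type) (_ : Fintype L) (_ : DecidableEq L) (_ : Fintype X) (_ : Fintype Y)
    (M : X → Y → Matrix (α ⊕ β → Fin 2) ((α → Fin 2) × (β → Fin 2)) ℂ)
    (p : X → Y → α ⊕ β → ZMod 2 × ZMod 2),
    CollectingProtocol L M ∧ Fintype.card L = 2 ^ m ∧
    (∀ x y, ∃ c : ℂ, M x y =
      c • (pauliString (p x y) * V.submatrix id fun q => Sum.elim q.1 q.2)) ∧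
    ∀ χ : (α ⊕ β → ZMod 2 × ZMod 2) →+ ZMod 2, Computes s₀ k fun x y => χ (p x y)

/-- After the teleportation of Bob's qubits the label is known to Bob, so one permutation of his
suffices to compute a functional of it. -/
theorem collectsUpToPauli_one (s₀ : S) :
    CollectsUpToPauli (Fintype.card β) s₀ 1 (1 : QubitOp (α ⊕ β)) := by
  obtain ⟨M, hM, h⟩ := collectingProtocol_teleport (α := α) (β := β)
  refine ⟨_, _, _, inferInstance, inferInstance, inferInstance, inferInstance, M, _, hM, by simp,
    fun x y => ?_, fun χ => Computes.bob s₀ fun y => χ (Sum.elim (fun _ => 0) y)⟩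
  obtain ⟨c, hc⟩ := h x y
  refine ⟨c, ?_⟩
  rw [hc]
  congr 1
  have h1 := Matrix.submatrix_mul_equiv (pauliString (Sum.elim (fun _ => 0) y))
    (1 : QubitOp (α ⊕ β)) id (Equiv.refl _) fun q : (α → Fin 2) × (β → Fin 2) => Sum.elim q.1 q.2
  rw [Matrix.mul_one] at h1
  exact h1.symm

theorem submatrix_elim_mul (C V : QubitOp (α ⊕ β)) :
    (C * V).submatrix id (fun q : (α → Fin 2) × (β → Fin 2) => Sum.elim q.1 q.2) =
      C * V.submatrix id fun q => Sum.elim q.1 q.2 := rfl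

theorem IsClifford.unitary {ι : Type*} [Fintype ι] [DecidableEq ι] {C : QubitOp ι}
    (hC : IsClifford C) : Cᴴ * C = 1 := Matrix.mem_unitaryGroup_iff'.1 hC.1

theorem tLayer_unitary {ι : Type*} [Fintype ι] [DecidableEq ι] (s : Finset ι) :
    (tLayer s)ᴴ * tLayer s = 1 := by
  refine qubitTensor_unitary fun i => ?_
  split_ifs
  · exact tGate_unitary
  · simp

theorem CollectsUpToPauli.clifford {m k : ℕ} {s₀ : S} {V C : QubitOp (α ⊕ β)}
    (h : CollectsUpToPauli m s₀ k V) (hC : IsClifford C) :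
    CollectsUpToPauli m s₀ k (C * V) := by
  obtain ⟨L, X, Y, _, _, _, _, M, p, hM, hL, hMp, hp⟩ := h
  obtain ⟨γ, hγ⟩ := hC.exists_label_hom
  refine ⟨L, X, Y, inferInstance, inferInstance, inferInstance, inferInstance, _,
    fun x y => γ (p x y), hM.isometry (D := fun _ => C) (fun _ => hC.unitary), hL, fun x y => ?_,
    fun χ => hp (χ.comp γ)⟩
  obtain ⟨c, hc⟩ := hMp x y
  obtain ⟨c', hc'⟩ := hγ (p x y)
  refine ⟨c * c', ?_⟩
  rw [hc, submatrix_elim_mul, Matrix.mul_smul, ← Matrix.mul_assoc, hc', Matrix.smul_mul, smul_smul,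
    Matrix.mul_assoc]

/-- A layer of `T` gates turns a Pauli error into phase errors, which are removed at the price of a
new Pauli error. -/
theorem CollectsUpToPauli.apply_tLayer [Fintype S] [DecidableEq S] {m k : ℕ} {s₀ : S}
    {V : QubitOp (α ⊕ β)} (h : CollectsUpToPauli m s₀ k V) (s : Finset (α ⊕ β)) :
    CollectsUpToPauli (m + 8 * (Fintype.card (α ⊕ β) * Fintype.card S) * k)
      ((s₀, (0 : ZMod 2)), (0 : ZMod 2 × ZMod 2)) ((4 * Fintype.card (α ⊕ β) + 1) * k)
      (tLayer s * V) := by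
  obtain ⟨L, X, Y, _, _, _, _, M, p, hM, hL, hMp, hp⟩ := h
  have hM1 := hM.isometry (D := fun _ => tLayer s) (fun _ => tLayer_unitary s)
  -- The exponents of the phase errors are linear functionals of the label.
  let f : α ⊕ β → X → Y → ZMod 2 := fun j x y => if j ∈ s then (p x y j).1 else 0
  have hf : ∀ j, Computes s₀ k (f j) := fun j => by
    by_cases hj : j ∈ s
    · simpa [f, hj] using
        hp ((AddMonoidHom.fst (ZMod 2) (ZMod 2)).comp (Pi.evalAddMonoidHom _ j))
    · simpa [f, hj] using hp 0
  obtain ⟨L', X', Y', _, _, _, _, u, v, M', e, hM', hL', hMe, he⟩ := hM1.remove_phases hL hf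
  refine ⟨L', X', Y', inferInstance, inferInstance, inferInstance, inferInstance, M',
    fun x y j => e j x y + p (u x) (v y) j, hM', hL', fun x y => ?_, fun χ => ?_⟩
  · obtain ⟨c, hc⟩ := hMe x y
    obtain ⟨c', hc'⟩ := hMp (u x) (v y)
    have hj : ∀ j, ∃ a : ℂ, sigma (e j x y) * phaseGateInv (f j (u x) (v y)) *
        ((if j ∈ s then tGate else 1) * sigma (p (u x) (v y) j)) =
        a • (sigma (e j x y + p (u x) (v y) j) * if j ∈ s then tGate else 1) := fun j => by
      obtain ⟨a, ha⟩ := sigma_mul (e j x y) (p (u x) (v y) j)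
      by_cases hj : j ∈ s
      · obtain ⟨b, hb⟩ := tGate_mul_sigma (p (u x) (v y) j)
        refine ⟨b * a, ?_⟩
        simp only [hj, if_true, f]
        rw [hb, Matrix.mul_smul, Matrix.mul_assoc (sigma _), ← Matrix.mul_assoc (phaseGateInv _),
          ← Matrix.mul_assoc (phaseGateInv _), phaseGateInv_mul_phaseGate, Matrix.one_mul,
          ← Matrix.mul_assoc, ha, Matrix.smul_mul, smul_smul]
      · exact ⟨a, by simp [hj, f, phaseGateInv, ha]⟩
    obtain ⟨a, ha⟩ := qubitTensor_proportional hj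
    refine ⟨c * c' * a, ?_⟩
    have hprod : qubitTensor (fun j => sigma (e j x y) * phaseGateInv (f j (u x) (v y))) *
        (tLayer s * pauliString (p (u x) (v y))) =
        a • (pauliString (fun j => e j x y + p (u x) (v y) j) * tLayer s) := by
      simp only [tLayer, pauliString, qubitTensor_mul]
      exact ha
    rw [hc, hc', submatrix_elim_mul, Matrix.mul_smul, Matrix.mul_smul, smul_smul, mul_smul (c * c'),
      ← Matrix.mul_assoc (tLayer s), ← Matrix.mul_assoc (qubitTensor _), hprod, Matrix.smul_mul,
      Matrix.mul_assoc]
  · have h1 : ∀ j, Computes ((s₀, (0 : ZMod 2)), (0 : ZMod 2 × ZMod 2)) (4 * k)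
        fun x y => χ (Pi.single j (e j x y)) := fun j => he j fun b => χ (Pi.single j b)
    have h2 := Computes.sum Finset.univ h1
    have h3 := (((hp χ).comap u v).prod (0 : ZMod 2)).prod (0 : ZMod 2 × ZMod 2)
    have h4 := (h2.add h3).mono (l := (4 * Fintype.card (α ⊕ β) + 1) * k) (by
      rw [Finset.card_univ]; exact le_of_eq (by ring))
    convert h4 using 3 with x y
    rw [← map_sum, ← map_add]
    congr 1
    rw [Finset.univ_sum_single (fun j => e j x y)]
    rfl

/-- The entanglement consumption of a Clifford+T circuit, layer by layer. -/
theorem CliffordTDecomposition.collectsUpToPauli {d : ℕ} {U : QubitOp (α ⊕ β)}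
    (hU : CliffordTDecomposition d U) :
    ∃ (S : Type) (_ : Fintype S) (_ : DecidableEq S) (s₀ : S) (m : ℕ),
      Fintype.card S = 8 ^ d ∧
      m = Fintype.card β + ∑ t ∈ Finset.range d, 8 * (Fintype.card (α ⊕ β) * 8 ^ t) *
        (4 * Fintype.card (α ⊕ β) + 1) ^ t ∧
      CollectsUpToPauli m s₀ ((4 * Fintype.card (α ⊕ β) + 1) ^ d) U := by
  induction hU with
  | clifford C hC =>
    refine ⟨Unit, inferInstance, inferInstance, (), _, rfl, rfl, ?_⟩
    simpa using (collectsUpToPauli_one (α := α) (β := β) ()).clifford hC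
  | layer d V C s hV hC ih =>
    obtain ⟨S, _, _, s₀, m, hS, hm, h⟩ := ih
    refine ⟨(S × ZMod 2) × ZMod 2 × ZMod 2, inferInstance, inferInstance, ((s₀, 0), 0), _, ?_, ?_,
      (by rw [pow_succ', Matrix.mul_assoc]; exact (h.apply_tLayer s).clifford hC)⟩
    · simp only [Fintype.card_prod, hS, show Fintype.card (ZMod 2) = 2 from rfl]
      ring
    · rw [hm, hS, Finset.sum_range_succ, add_assoc]

theorem CliffordTDecomposition.unitary {ι : Type*} [Fintype ι] [DecidableEq ι] {d : ℕ}
    {U : QubitOp ι} (hU : CliffordTDecomposition d U) : Uᴴ * U = 1 := by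
  have hmul : ∀ {A B : QubitOp ι}, Aᴴ * A = 1 → Bᴴ * B = 1 → (A * B)ᴴ * (A * B) = 1 :=
    fun {A B} hA hB => by
      rw [Matrix.conjTranspose_mul, Matrix.mul_assoc, ← Matrix.mul_assoc Aᴴ, hA, Matrix.one_mul, hB]
  induction hU with
  | clifford C hC => exact hC.unitary
  | layer d V C s hV hC ih => exact hmul (hmul hC.unitary (tLayer_unitary s)) ih

end Circuits

/-- The geometric sum that bounds the entanglement consumption. For `d = 0` it fails as soon as
`b > 1`, because Bob's qubits are teleported in any case. -/
theorem epr_count_le {b n d : ℕ} (hb : b ≤ n) (hd : 1 ≤ d) :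
    b + ∑ t ∈ Finset.range d, 8 * (n * 8 ^ t) * (4 * n + 1) ^ t ≤ (40 * n) ^ d := by
  rcases Nat.eq_zero_or_pos n with rfl | hn
  · simp [Nat.le_zero.1 hb]
  induction d, hd using Nat.le_induction with
  | base => simp; omega
  | succ d hd ih =>
    rw [Finset.sum_range_succ, ← add_assoc]
    have h1 : 8 ^ d * (4 * n + 1) ^ d ≤ (40 * n) ^ d := by
      rw [← mul_pow]
      exact Nat.pow_le_pow_left (by omega) d
    calc _ ≤ (40 * n) ^ d + 8 * n * (8 ^ d * (4 * n + 1) ^ d) := by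
          refine add_le_add ih (le_of_eq ?_); ring
      _ ≤ (40 * n) ^ d + 8 * n * (40 * n) ^ d := by gcongr
      _ = (8 * n + 1) * (40 * n) ^ d := by ring
      _ ≤ (40 * n) * (40 * n) ^ d := Nat.mul_le_mul_right _ (by omega)
      _ = _ := (pow_succ' _ _).symm

/-! ### Channels in Kraus form -/

section Kraus

/-- The linear map `ρ ↦ ∑ E_k ρ E_k†`. -/
def krausMap {A B κ : Type*} [Fintype A] [Fintype B] [Fintype κ] (E : κ → Matrix B A ℂ) :
    Matrix A A ℂ →ₗ[ℂ] Matrix B B ℂ where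
  toFun ρ := ∑ k, E k * ρ * (E k)ᴴ
  map_add' ρ σ := by simp only [Matrix.mul_add, Matrix.add_mul, Finset.sum_add_distrib]
  map_smul' c ρ := by simp [Finset.smul_sum]

theorem krausMap_apply {A B κ : Type*} [Fintype A] [Fintype B] [Fintype κ] (E : κ → Matrix B A ℂ)
    (ρ : Matrix A A ℂ) : krausMap E ρ = ∑ k, E k * ρ * (E k)ᴴ := rfl

theorem krausMap_krausMap {A B C κ ν : Type*} [Fintype A] [Fintype B] [Fintype C] [Fintype κ]
    [Fintype ν] (E : κ → Matrix B A ℂ) (F : ν → Matrix C B ℂ) (ρ : Matrix A A ℂ) :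
    krausMap F (krausMap E ρ) = krausMap (fun p : κ × ν => F p.2 * E p.1) ρ := by
  simp only [krausMap_apply, Fintype.sum_prod_type_right, Matrix.mul_sum, Matrix.sum_mul,
    Matrix.conjTranspose_mul, Matrix.mul_assoc]

theorem isChannel_krausMap {A B : Type*} {κ : Type} [Fintype A] [DecidableEq A] [Fintype B]
    [Fintype κ] {E : κ → Matrix B A ℂ} (hE : ∑ k, (E k)ᴴ * E k = 1) : IsChannel (krausMap E) :=
  ⟨κ, inferInstance, E, hE, fun _ => rfl⟩

variable {A B C D κ ν : Type*} [Fintype A] [DecidableEq A] [Fintype B] [DecidableEq B]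
  [Fintype C] [Fintype D] [Fintype κ] [Fintype ν]

/-- Kraus operators of a tensor product are the tensor products of the Kraus operators. -/
theorem channelTensor_krausMap (E : κ → Matrix C A ℂ) (F : ν → Matrix D B ℂ)
    (ρ : Matrix (A × B) (A × B) ℂ) :
    channelTensor (krausMap E) (krausMap F) ρ =
      krausMap (fun p : κ × ν => E p.1 ⊗ₖ F p.2) ρ := by
  have hprod : ∀ (X : Matrix A A ℂ) (Y : Matrix B B ℂ), krausMap E X ⊗ₖ krausMap F Y =
      krausMap (fun p : κ × ν => E p.1 ⊗ₖ F p.2) (X ⊗ₖ Y) := fun X Y => by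
    simp only [krausMap_apply, Matrix.conjTranspose_kronecker, ← Matrix.mul_kronecker_mul]
    ext ⟨c, d⟩ ⟨c', d'⟩
    simp only [Matrix.sum_apply, Matrix.kroneckerMap_apply, Fintype.sum_prod_type,
      Finset.sum_mul_sum]
  rw [linearMap_eq_sum_single (krausMap _) ρ]
  simp only [channelTensor, hprod, Matrix.single_kronecker_single, mul_one, Fintype.sum_prod_type]
  exact Fintype.sum_congr _ _ fun i => Finset.sum_comm

end Kraus

section NLQC

variable {A B L R Ka Ma Kb Mb A' B' κ₁ κ₂ κ₃ κ₄ : Type*}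
  [Fintype A] [DecidableEq A] [Fintype B] [DecidableEq B]
  [Fintype L] [Fintype R]
  [Fintype Ka] [DecidableEq Ka] [Fintype Ma] [DecidableEq Ma]
  [Fintype Kb] [DecidableEq Kb] [Fintype Mb] [DecidableEq Mb]
  [Fintype A'] [Fintype B'] [Fintype κ₁] [Fintype κ₂] [Fintype κ₃] [Fintype κ₄]

/-- The operator that supplies the resource state `ψ` and distributes the systems. -/
def supplyResource (A B : Type*) [DecidableEq A] [DecidableEq B] (ψ : L × R → ℂ) :
    Matrix ((A × L) × (R × B)) (A × B) ℂ :=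
  Matrix.of fun s t => (1 : Matrix (A × B) (A × B) ℂ) (s.1.1, s.2.2) t * ψ (s.1.2, s.2.1)

theorem supplyResource_isometry {ψ : L × R → ℂ} (hψ : ∑ s, star (ψ s) * ψ s = 1) :
    (supplyResource A B ψ)ᴴ * supplyResource A B ψ = 1 := by
  let e : (A × L) × (R × B) ≃ (A × B) × (L × R) :=
    ⟨fun p => ((p.1.1, p.2.2), (p.1.2, p.2.1)), fun p => ((p.1.1, p.2.1), (p.2.2, p.1.2)),
      fun _ => rfl, fun _ => rfl⟩
  have h1 : (Matrix.replicateCol Unit ψ)ᴴ * Matrix.replicateCol Unit ψ = 1 := by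
    ext
    simpa [Matrix.mul_apply] using hψ
  have h2 := sum_submatrix_conjTranspose_mul (κ := Unit)
    (E := fun _ => (1 : Matrix (A × B) (A × B) ℂ) ⊗ₖ Matrix.replicateCol Unit ψ)
    (by
      rw [Finset.univ_unique, Finset.sum_singleton, Matrix.conjTranspose_kronecker,
        ← Matrix.mul_kronecker_mul, h1, Matrix.conjTranspose_one, Matrix.one_mul,
        Matrix.one_kronecker_one]) e
    (Equiv.prodPUnit (A × B)).symm
  rw [Finset.univ_unique, Finset.sum_singleton] at h2
  exact h2

/-- The Kraus operators of a non-local quantum computation with a pure resource state. -/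
def nlqcKraus (ψ : L × R → ℂ) (E : Matrix (Ka × Mb) (A × L) ℂ) (F : Matrix (Ma × Kb) (R × B) ℂ)
    (W : Matrix A' (Ka × Ma) ℂ) (W' : Matrix B' (Kb × Mb) ℂ) : Matrix (A' × B') (A × B) ℂ :=
  (W ⊗ₖ W') * ((E ⊗ₖ F) * supplyResource A B ψ).submatrix
    (fun p : (Ka × Ma) × (Kb × Mb) => ((p.1.1, p.2.2), (p.1.2, p.2.1))) id

theorem nlqcMap_krausMap [DecidableEq L] [DecidableEq R] (ψ : L × R → ℂ)
    (E : κ₁ → Matrix (Ka × Mb) (A × L) ℂ)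
    (F : κ₂ → Matrix (Ma × Kb) (R × B) ℂ) (W : κ₃ → Matrix A' (Ka × Ma) ℂ)
    (W' : κ₄ → Matrix B' (Kb × Mb) ℂ) (ρ : Matrix (A × B) (A × B) ℂ) :
    nlqcMap (Matrix.vecMulVec ψ (star ψ)) (krausMap E) (krausMap F) (krausMap W) (krausMap W') ρ =
      krausMap (fun p : (κ₁ × κ₂) × (κ₃ × κ₄) =>
        nlqcKraus ψ (E p.1.1) (F p.1.2) (W p.2.1) (W' p.2.2)) ρ := by
  have hρ : (ρ ⊗ₖ Matrix.vecMulVec ψ (star ψ)).submatrix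
      (fun p : (A × L) × (R × B) => ((p.1.1, p.2.2), (p.1.2, p.2.1)))
      (fun p => ((p.1.1, p.2.2), (p.1.2, p.2.1))) =
      supplyResource A B ψ * ρ * (supplyResource A B ψ)ᴴ := by
    ext s t
    have h1 : ∀ t u, (supplyResource A B ψ * ρ) t u =
        ψ (t.1.2, t.2.1) * ρ (t.1.1, t.2.2) u := fun t u => by
      simp [supplyResource, Matrix.mul_apply, Matrix.one_apply]
    rw [Matrix.mul_apply]
    simp only [h1]
    simp only [supplyResource, Matrix.conjTranspose_apply, Matrix.of_apply, Matrix.one_apply,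
      Matrix.submatrix_apply, Matrix.kroneckerMap_apply, Matrix.vecMulVec_apply, Pi.star_apply,
      ite_mul, one_mul, zero_mul, apply_ite star, star_zero, mul_ite, mul_zero, Finset.sum_ite_eq,
      Finset.mem_univ, if_true]
    ring
  have hround : ∀ K : κ₁ × κ₂ → Matrix ((Ka × Mb) × (Ma × Kb)) ((A × L) × (R × B)) ℂ,
      (krausMap K (supplyResource A B ψ * ρ * (supplyResource A B ψ)ᴴ)).submatrix
        (fun p : (Ka × Ma) × (Kb × Mb) => ((p.1.1, p.2.2), (p.1.2, p.2.1)))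
        (fun p => ((p.1.1, p.2.2), (p.1.2, p.2.1))) =
      krausMap (fun k => (K k * supplyResource A B ψ).submatrix
        (fun p : (Ka × Ma) × (Kb × Mb) => ((p.1.1, p.2.2), (p.1.2, p.2.1))) id) ρ := fun K => by
    ext s t
    simp only [krausMap_apply, Matrix.submatrix_apply, Matrix.sum_apply]
    refine Fintype.sum_congr _ _ fun k => ?_
    rw [show K k * (supplyResource A B ψ * ρ * (supplyResource A B ψ)ᴴ) * (K k)ᴴ =
      K k * supplyResource A B ψ * ρ * (K k * supplyResource A B ψ)ᴴ by
        simp only [Matrix.conjTranspose_mul, Matrix.mul_assoc]]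
    rfl
  simp only [nlqcMap, channelTensor_krausMap, hρ, hround]
  rw [krausMap_krausMap]
  rfl

theorem sum_nlqcKraus [DecidableEq L] [DecidableEq R] {ψ : L × R → ℂ}
    (hψ : ∑ s, star (ψ s) * ψ s = 1) {E : κ₁ → Matrix (Ka × Mb) (A × L) ℂ}
    (hE : ∑ k, (E k)ᴴ * E k = 1) {F : κ₂ → Matrix (Ma × Kb) (R × B) ℂ} (hF : ∑ k, (F k)ᴴ * F k = 1)
    {W : κ₃ → Matrix A' (Ka × Ma) ℂ} (hW : ∑ k, (W k)ᴴ * W k = 1)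
    {W' : κ₄ → Matrix B' (Kb × Mb) ℂ} (hW' : ∑ k, (W' k)ᴴ * W' k = 1) :
    ∑ p : (κ₁ × κ₂) × (κ₃ × κ₄),
      (nlqcKraus ψ (E p.1.1) (F p.1.2) (W p.2.1) (W' p.2.2))ᴴ *
        nlqcKraus ψ (E p.1.1) (F p.1.2) (W p.2.1) (W' p.2.2) = 1 := by
  let e : (Ka × Ma) × (Kb × Mb) ≃ (Ka × Mb) × (Ma × Kb) :=
    ⟨fun p => ((p.1.1, p.2.2), (p.1.2, p.2.1)), fun p => ((p.1.1, p.2.1), (p.2.2, p.1.2)),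
      fun _ => rfl, fun _ => rfl⟩
  have h1 : ∑ p : κ₁ × κ₂, ((E p.1 ⊗ₖ F p.2) * supplyResource A B ψ)ᴴ *
      ((E p.1 ⊗ₖ F p.2) * supplyResource A B ψ) = 1 := by
    have h := sum_comp_conjTranspose_mul (κ := Unit) (E := fun _ => supplyResource A B ψ)
      (by simpa using supplyResource_isometry hψ)
      (F := fun _ (p : κ₁ × κ₂) => E p.1 ⊗ₖ F p.2)
      (fun _ => sum_kronecker_conjTranspose_mul (F := fun _ l => F l) hE fun _ => hF)
    rwa [Fintype.sum_prod_type, Finset.univ_unique, Finset.sum_singleton] at h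
  have h2 := sum_submatrix_conjTranspose_mul
    (E := fun p : κ₁ × κ₂ => (E p.1 ⊗ₖ F p.2) * supplyResource A B ψ) h1 e (Equiv.refl (A × B))
  have h3 : ∑ q : κ₃ × κ₄, (W q.1 ⊗ₖ W' q.2)ᴴ * (W q.1 ⊗ₖ W' q.2) = 1 :=
    sum_kronecker_conjTranspose_mul (F := fun _ l => W' l) hW fun _ => hW'
  exact sum_comp_conjTranspose_mul
    (E := fun p : κ₁ × κ₂ => ((E p.1 ⊗ₖ F p.2) * supplyResource A B ψ).submatrix e
      (Equiv.refl (A × B))) h2 (F := fun _ (q : κ₃ × κ₄) => W q.1 ⊗ₖ W' q.2) fun _ => h3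

/-- If all Kraus operators are proportional to `U`, then the channel is conjugation by `U`. -/
theorem krausMap_eq_conj {κ : Type*} [Fintype κ] {G : κ → Matrix A A ℂ} {U : Matrix A A ℂ}
    (hG : ∑ k, (G k)ᴴ * G k = 1) (hU : Uᴴ * U = 1) (h : ∀ k, ∃ c : ℂ, G k = c • U)
    (ρ : Matrix A A ℂ) : krausMap G ρ = U * ρ * Uᴴ := by
  choose c hc using h
  have h1 : (∑ k, c k * star (c k)) • (1 : Matrix A A ℂ) = 1 := by
    refine Eq.trans ?_ hG
    rw [Finset.sum_smul]
    refine Fintype.sum_congr _ _ fun k => ?_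
    rw [hc, Matrix.conjTranspose_smul, smul_mul_smul_comm, hU, mul_comm]
  calc krausMap G ρ = (∑ k, c k * star (c k)) • (U * ρ * Uᴴ) := by
        rw [krausMap_apply, Finset.sum_smul]
        refine Fintype.sum_congr _ _ fun k => ?_
        rw [hc, Matrix.conjTranspose_smul, Matrix.smul_mul, smul_mul_smul_comm]
    _ = ((∑ k, c k * star (c k)) • (1 : Matrix A A ℂ)) * (U * ρ * Uᴴ) := by
        rw [Matrix.smul_mul, Matrix.one_mul]
    _ = _ := by rw [h1, Matrix.one_mul]

end NLQC

/-! ### From collecting protocols to non-local computations -/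

section Final

/-- The state of `m` EPR pairs is a maximally entangled state of the two halves. -/
theorem eprPairs_eq (m : ℕ) : ∃ (ψ : (Fin m → Fin 2) × (Fin m → Fin 2) → ℂ) (c : ℂ),
    eprPairs m = Matrix.vecMulVec ψ (star ψ) ∧ ∑ s, star (ψ s) * ψ s = 1 ∧
      ∀ l r, ψ (l, r) = if l = r then c else 0 := by
  have hsq : ((Real.sqrt 2 : ℝ) : ℂ) * ((Real.sqrt 2 : ℝ) : ℂ) = 2 := by
    rw [← Complex.ofReal_mul, Real.mul_self_sqrt (by norm_num)]; norm_num
  have hψ : ∀ l r : Fin m → Fin 2, (∏ i, eprAmplitude (l i) (r i)) =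
      if l = r then (1 / ((Real.sqrt 2 : ℝ) : ℂ)) ^ m else 0 := fun l r => by
    simp [eprAmplitude, Finset.prod_ite_zero, funext_iff]
  refine ⟨_, (1 / ((Real.sqrt 2 : ℝ) : ℂ)) ^ m, rfl, ?_, hψ⟩
  simp only [hψ, Fintype.sum_prod_type]
  have h1 : star ((1 / ((Real.sqrt 2 : ℝ) : ℂ)) ^ m) * (1 / ((Real.sqrt 2 : ℝ) : ℂ)) ^ m =
      (1 / 2) ^ m := by
    rw [star_pow, ← mul_pow]
    congr 1
    simp only [one_div, RCLike.star_def, map_inv₀, Complex.conj_ofReal, ← mul_inv, hsq]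
  simp only [mul_ite, mul_zero, Finset.sum_ite_eq, Finset.mem_univ, if_true, h1]
  simp

variable {α β : Type} [Fintype α] [DecidableEq α] [Fintype β] [DecidableEq β]

/-- In a non-local computation, Alice and Bob follow the protocol in the first round, exchange their
outcomes together with Bob's share of the result, and undo the Pauli error in the second round. -/
theorem CollectsUpToPauli.implementableWithEPR {S : Type} {m k : ℕ} {s₀ : S} {U : QubitOp (α ⊕ β)}
    (h : CollectsUpToPauli m s₀ k U) (hU : Uᴴ * U = 1) : ImplementableWithEPR (bipartite U) m := by
  classical
  obtain ⟨L, X, Y, _, _, _, _, M, p, ⟨E, F, hE, hF, hM⟩, hL, hMp, -⟩ := h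
  obtain ⟨ψ, c₀, hΨ, hψ, hψc⟩ := eprPairs_eq m
  obtain ⟨w⟩ : Nonempty ((Fin m → Fin 2) ≃ L) := Fintype.card_eq.1 (by simp [hL])
  -- The outcomes are recorded twice, once to be kept and once to be sent. In the second round both
  -- parties read them and apply their tensor factor of the Pauli error, which is its own inverse.
  let VE : X → Matrix (((α → Fin 2) × X) × ((β → Fin 2) × X)) ((α → Fin 2) × (Fin m → Fin 2)) ℂ :=
    fun x => Matrix.of fun s t =>
      if s.1.2 = x ∧ s.2.2 = x then E x (Sum.elim s.1.1 s.2.1) (t.1, w t.2) else 0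
  let VF : Y → Matrix (Y × Y) ((Fin m → Fin 2) × (β → Fin 2)) ℂ :=
    fun y => Matrix.of fun s t => if s.1 = y ∧ s.2 = y then F y () (w t.1, t.2) else 0
  let WA : X × Y → Matrix (α → Fin 2) (((α → Fin 2) × X) × Y) ℂ :=
    fun z => Matrix.of fun r s =>
      if s.1.2 = z.1 ∧ s.2 = z.2 then pauliString (fun i => p z.1 z.2 (Sum.inl i)) r s.1.1 else 0
  let WB : X × Y → Matrix (β → Fin 2) (Y × ((β → Fin 2) × X)) ℂ :=
    fun z => Matrix.of fun r s =>
      if s.2.2 = z.1 ∧ s.1 = z.2 then pauliString (fun i => p z.1 z.2 (Sum.inr i)) r s.2.1 else 0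
  have hVE : ∑ x, (VE x)ᴴ * VE x = 1 := by
    ext ⟨a, l⟩ ⟨a', l'⟩
    have h1 := congrFun (congrFun hE (a, w l)) (a', w l')
    have h2 : (1 : Matrix ((α → Fin 2) × L) _ ℂ) (a, w l) (a', w l') =
        (1 : Matrix ((α → Fin 2) × (Fin m → Fin 2)) _ ℂ) (a, l) (a', l') := by
      simp [Matrix.one_apply]
    rw [← h2, ← h1]
    simp only [Matrix.sum_apply]
    refine Fintype.sum_congr _ _ fun x => ?_
    rw [Matrix.mul_apply, Matrix.mul_apply,
      ← (Equiv.sumArrowEquivProdArrow α β (Fin 2)).symm.sum_comp]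
    simp only [VE, Fintype.sum_prod_type, Matrix.conjTranspose_apply, Matrix.of_apply]
    refine Fintype.sum_congr _ _ fun a1 => ?_
    rw [Finset.sum_eq_single x (fun x1 _ hne => by simp [hne]) (by simp)]
    refine Fintype.sum_congr _ _ fun b1 => ?_
    rw [Finset.sum_eq_single x (fun x2 _ hne => by simp [hne]) (by simp)]
    simp only [and_self, if_true]
    rfl
  have hVF : ∑ y, (VF y)ᴴ * VF y = 1 := by
    ext ⟨r, b⟩ ⟨r', b'⟩
    have h1 := congrFun (congrFun hF (w r, b)) (w r', b')
    have h2 : (1 : Matrix (L × (β → Fin 2)) _ ℂ) (w r, b) (w r', b') =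
        (1 : Matrix ((Fin m → Fin 2) × (β → Fin 2)) _ ℂ) (r, b) (r', b') := by
      simp [Matrix.one_apply]
    rw [← h2, ← h1]
    simp only [Matrix.sum_apply]
    refine Fintype.sum_congr _ _ fun y => ?_
    rw [Matrix.mul_apply, Matrix.mul_apply]
    simp only [VF, Matrix.conjTranspose_apply, Matrix.of_apply]
    rw [Finset.sum_eq_single (y, y)]
    · simp
    · rintro ⟨y1, y2⟩ - hne
      simp [show ¬(y1 = y ∧ y2 = y) from fun h => hne (by rw [h.1, h.2])]
    · simp
  have hWA : ∑ z, (WA z)ᴴ * WA z = 1 := by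
    ext ⟨⟨a, x⟩, y⟩ ⟨⟨a', x'⟩, y'⟩
    rw [Matrix.sum_apply, Finset.sum_eq_single (x, y)]
    · have h1 := congrFun (congrFun (pauliString_mul_self fun i => p x y (Sum.inl i)) a) a'
      nth_rw 1 [← pauliString_conjTranspose] at h1
      rw [Matrix.mul_apply] at h1 ⊢
      by_cases hxy : x' = x ∧ y' = y
      · obtain ⟨rfl, rfl⟩ := hxy
        simpa [WA, Matrix.one_apply] using h1
      · have hne : ¬(((a, x), y) = ((a', x'), y')) := fun h => hxy (by simp_all)
        rw [Matrix.one_apply_ne hne]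
        exact Finset.sum_eq_zero fun r _ => by simp [WA, hxy]
    · rintro ⟨x1, y1⟩ - hne
      have hxy : ¬(x = x1 ∧ y = y1) := fun h => hne (by rw [h.1, h.2])
      rw [Matrix.mul_apply]
      exact Finset.sum_eq_zero fun r _ => by simp [WA, hxy]
    · simp
  have hWB : ∑ z, (WB z)ᴴ * WB z = 1 := by
    ext ⟨y, ⟨b, x⟩⟩ ⟨y', ⟨b', x'⟩⟩
    rw [Matrix.sum_apply, Finset.sum_eq_single (x, y)]
    · have h1 := congrFun (congrFun (pauliString_mul_self fun i => p x y (Sum.inr i)) b) b'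
      nth_rw 1 [← pauliString_conjTranspose] at h1
      rw [Matrix.mul_apply] at h1 ⊢
      by_cases hxy : x' = x ∧ y' = y
      · obtain ⟨rfl, rfl⟩ := hxy
        simpa [WB, Matrix.one_apply] using h1
      · have hne : ¬((y, (b, x)) = (y', (b', x'))) := fun h => hxy (by simp_all)
        rw [Matrix.one_apply_ne hne]
        exact Finset.sum_eq_zero fun r _ => by simp [WB, hxy]
    · rintro ⟨x1, y1⟩ - hne
      have hxy : ¬(x = x1 ∧ y = y1) := fun h => hne (by rw [h.1, h.2])
      rw [Matrix.mul_apply]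
      exact Finset.sum_eq_zero fun r _ => by simp [WB, hxy]
    · simp
  have hU' : (bipartite U)ᴴ * bipartite U = 1 := by
    have h1 := Matrix.submatrix_mul_equiv Uᴴ U
      (Equiv.sumArrowEquivProdArrow α β (Fin 2)).symm
      (Equiv.sumArrowEquivProdArrow α β (Fin 2)).symm
      (Equiv.sumArrowEquivProdArrow α β (Fin 2)).symm
    rw [hU, Matrix.submatrix_one_equiv] at h1
    exact h1
  refine ⟨(α → Fin 2) × X, Y, Y, (β → Fin 2) × X, inferInstance, inferInstance, inferInstance,
    inferInstance, inferInstance, inferInstance, inferInstance, inferInstance,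
    krausMap VE, krausMap VF, krausMap WA, krausMap WB, isChannel_krausMap hVE,
    isChannel_krausMap hVF, isChannel_krausMap hWA, isChannel_krausMap hWB, fun ρ => ?_⟩
  rw [hΨ, nlqcMap_krausMap]
  refine krausMap_eq_conj (sum_nlqcKraus hψ hVE hVF hWA hWB) hU' ?_ ρ
  rintro ⟨⟨x, y⟩, ⟨x₁, y₁⟩, ⟨x₂, y₂⟩⟩
  have hfirst : ∀ s ab, ((VE x ⊗ₖ VF y) * supplyResource (α → Fin 2) (β → Fin 2) ψ) s ab =
      if (s.1.1.2 = x ∧ s.1.2.2 = x) ∧ (s.2.1 = y ∧ s.2.2 = y) then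
        c₀ * M x y (Sum.elim s.1.1.1 s.1.2.1) ab else 0 := by
    rintro s ⟨a, b⟩
    rw [hM, Matrix.mul_apply]
    simp only [Fintype.sum_prod_type, supplyResource, Matrix.of_apply, hψc, Matrix.one_apply,
      Prod.mk.injEq, Matrix.kroneckerMap_apply]
    rw [Finset.sum_eq_single a (fun a1 _ hne => by simp [hne]) (by simp)]
    have hl : ∀ l, (∑ r, ∑ b1, VE x s.1 (a, l) * VF y s.2 (r, b1) *
        ((if a = a ∧ b1 = b then 1 else 0) * if l = r then c₀ else 0)) =
        VE x s.1 (a, l) * VF y s.2 (l, b) * c₀ := fun l => by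
      rw [Finset.sum_eq_single l (fun r _ hne => by simp [hne.symm]) (by simp),
        Finset.sum_eq_single b (fun b1 _ hne => by simp [hne]) (by simp)]
      simp
    rw [Fintype.sum_congr _ _ hl]
    simp only [VE, VF, Matrix.of_apply]
    by_cases hx : s.1.1.2 = x ∧ s.1.2.2 = x
    · by_cases hy : s.2.1 = y ∧ s.2.2 = y
      · simp only [hx, hy, and_self, if_true]
        rw [← w.sum_comp, Finset.mul_sum]
        exact Fintype.sum_congr _ _ fun l => mul_comm _ _
      · simp [hy]
    · simp [hx]
  -- The outcomes read in the second round are the recorded ones, or the operator is zero.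
  have hterm : ∀ r ab, nlqcKraus ψ (VE x) (VF y) (WA (x₁, y₁)) (WB (x₂, y₂)) r ab =
      if (x₁ = x ∧ x₂ = x) ∧ (y₁ = y ∧ y₂ = y) then
        c₀ * (pauliString (p x y) * M x y) (Sum.elim r.1 r.2) ab else 0 := by
    rintro ⟨a, b⟩ ab
    rw [nlqcKraus, Matrix.mul_apply, Matrix.mul_apply,
      ← (Equiv.sumArrowEquivProdArrow α β (Fin 2)).symm.sum_comp]
    simp only [Matrix.submatrix_apply, hfirst, id, Fintype.sum_prod_type,
      Matrix.kroneckerMap_apply, WA, WB, Matrix.of_apply]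
    have hp : ∀ a1 b1, pauliString (p x y) (Sum.elim a b) (Sum.elim a1 b1) =
        pauliString (fun i => p x y (Sum.inl i)) a a1 *
          pauliString (fun i => p x y (Sum.inr i)) b b1 := fun a1 b1 =>
      Fintype.prod_sum_type _
    by_cases hxy : (x₁ = x ∧ x₂ = x) ∧ (y₁ = y ∧ y₂ = y)
    · obtain ⟨⟨rfl, rfl⟩, rfl, rfl⟩ := hxy
      simp only [and_self, if_true]
      rw [Finset.mul_sum]
      refine Fintype.sum_congr _ _ fun a1 => ?_
      rw [Finset.sum_eq_single x₂ (fun x' _ hne => by simp [hne]) (by simp),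
        Finset.sum_eq_single y₂ (fun y' _ hne => by simp [hne]) (by simp),
        Finset.sum_eq_single y₂ (fun y' _ hne => by simp [hne]) (by simp), Finset.mul_sum]
      refine Fintype.sum_congr _ _ fun b1 => ?_
      rw [Finset.sum_eq_single x₂ (fun x' _ hne => by simp [hne]) (by simp)]
      simp only [and_self, if_true]
      change _ = c₀ * (pauliString (p x₂ y₂) (Sum.elim a b) (Sum.elim a1 b1) *
        M x₂ y₂ (Sum.elim a1 b1) ab)
      rw [hp]
      ring
    · rw [if_neg hxy]
      refine Finset.sum_eq_zero fun a1 _ => Finset.sum_eq_zero fun x' _ =>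
        Finset.sum_eq_zero fun y' _ => Finset.sum_eq_zero fun y'' _ =>
        Finset.sum_eq_zero fun b1 _ => Finset.sum_eq_zero fun x'' _ => ?_
      by_contra hne
      apply hxy
      simp only [mul_eq_zero, ite_eq_right_iff, not_or, Classical.not_imp] at hne
      obtain ⟨⟨⟨⟨rfl, rfl⟩, _⟩, ⟨rfl, rfl⟩, _⟩, h, _⟩ := hne
      exact h
  by_cases hxy : (x₁ = x ∧ x₂ = x) ∧ (y₁ = y ∧ y₂ = y)
  · obtain ⟨c, hc⟩ := hMp x y
    refine ⟨c₀ * c, ?_⟩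
    ext r ab
    rw [hterm, if_pos hxy, hc, Matrix.mul_smul, ← Matrix.mul_assoc, pauliString_mul_self,
      Matrix.one_mul, Matrix.smul_apply, Matrix.smul_apply, smul_eq_mul, smul_eq_mul, mul_assoc]
    rfl
  · refine ⟨0, ?_⟩
    ext r ab
    rw [hterm, if_neg hxy, zero_smul, Matrix.zero_apply]

end Final

end

theorem mainTheorem2 :
    ∃ K c : ℕ, ∀ (a b d : ℕ) (U : QubitOp (Fin a ⊕ Fin b)), 1 ≤ d →
      CliffordTDecomposition d U →
        ∃ m : ℕ, m ≤ c * (K * (a + b)) ^ d ∧ ImplementableWithEPR (bipartite U) m := by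
  refine ⟨40, 1, fun a b d U hd hU => ?_⟩
  obtain ⟨S, _, _, s₀, m, -, hm, h⟩ := hU.collectsUpToPauli
  refine ⟨m, ?_, h.implementableWithEPR hU.unitary⟩
  rw [hm, one_mul]
  simpa using epr_count_le (Nat.le_add_left b a) hd
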